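/- **Setting.** Let $\mathcal S\subseteq\{0,1\}^n$ be non-empty and let $\mathcal Q\subseteq\mathbb R^n_+$ be a polyhedron with $\mathcal S\subseteq\mathcal Q$ (the feasible set of an LP relaxation). Let $c^0,c^1,\dots,c^k\in\mathbb R^n_+$ with $c^1,\dots,c^k$ not all zero, $A=(a_{ir})\in\mathbb R^{m\times k}_+$, $b\in\mathbb R^m_+$, and $$\mathcal C=\Big\{c^0+\sum_{r=1}^k\delta_r c^r:\ \delta\in\mathbb R^k_+,\ A\delta\le b\Big\},\qquad \mathrm{OPT}_R=\min_{x\in\mathcal S}\max_{c\in\mathcal C}c^Tx .$$ Put $\beta=\min_r\max_i a_{ir}$, assumed positive, $\gamma=\max_{i,r}a_{ir}$, $c_{\min}=\min\{c^r_j: r\ge1,\ c^r_j>0\}$ and $c_{\max}=\max_{r\ge1,\,j}c^r_j$. For $\alpha\ge1$, an *$\alpha$-approximate negatively correlated randomized rounding ($\alpha$-ANCRR) verifier* is a randomized procedure that, given any $x\in\mathcal Q$, returns a random $\hat x\in\mathcal S$ such that (i) $\mathbb E[c^T\hat x]\le\alpha\,c^Tx$ for all $c\in\mathbb R^n_+$,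 and (ii) $\Pr[\hat x_i=1\ \forall i\in T]\le\prod_{i\in T}\Pr[\hat x_i=1]$ for all $T\subseteq\{1,\dots,n\}$. An *algorithm* here is one fixed program for a real random access machine (exact arithmetic and comparisons on reals, registers for indices, bounded loops) that receives $n,k,m,c^0,\dots,c^k,A,b$ as input. It reaches $\mathcal S$ only by calling the verifier (distinct calls use independent randomness), and reaches $\mathcal Q$ only by solving linear programs over $\mathcal Q$, possibly with additional explicitly given linear constraints and additional nonnegative variables. Solving such a linear program returns some optimal solution, or reports that there is none. An arithmetic operation costs one step, a linear program costs its explicit size, and a verifier call costs the length of its argument. **Theorem.** There are a single algorithm, an absolute constant $K$, a polynomial $p$, and a function $\eta$ with $\eta(L)\to0$ as $L\to\infty$, such that the following holds for all data as above, every $\alpha\ge1$, every $\alpha$-ANCRR verifier and every solver of linear programs over $\mathcal Q$. With $L=n+k+m$, the algorithm always halts after at most $p(L)$ verifier calls and at most $p(L)$ steps, it always outputs a vector $\hat x\in\mathcal S$, and $$\Pr\left[\,c^T\hat x\le K\,\alpha\sqrt{k\,\log(\max\{k,2\})\,\frac{\gamma}{\beta}\,\frac{c_{\max}}{c_{\min}}}\;\cdot\mathrm{OPT}_R\quad\forall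 c\in\mathcal C\right]\ \ge\ 1-\eta(L).$$ That is, there is an $O\big(\alpha\sqrt{k\log k\cdot\frac{\gamma}{\beta}\cdot\frac{c_{\max}}{c_{\min}}}\big)$-robust-with-high-probability algorithm that uses polynomially many calls to an $\alpha$-ANCRR verifier. -/

import Mathlib

open Filter Topology

namespace RobustDO

noncomputable section

/-! ## The robust discrete optimization problem -/

/-- Polyhedral perturbation set: all `δ ∈ ℝ₊ᵏ` with `A δ ≤ b`. -/
def perturbations {k m : ℕ} (A : Matrix (Fin m) (Fin k) ℝ) (b : Fin m → ℝ) :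
    Set (Fin k → ℝ) :=
  {δ | 0 ≤ δ ∧ A.mulVec δ ≤ b}

/-- Uncertainty set: all objectives `c⁰ + ∑ r, δ r • cʳ` with `δ` in the perturbation set.
The generator `cʳ` is `C r`. -/
def uncertaintySet {n k m : ℕ} (c0 : Fin n → ℝ) (C : Fin k → Fin n → ℝ)
    (A : Matrix (Fin m) (Fin k) ℝ) (b : Fin m → ℝ) : Set (Fin n → ℝ) :=
  {c | ∃ δ ∈ perturbations A b, c = c0 + ∑ r, δ r • C r}

/-- Worst-case objective value of `x` over the uncertainty set `U`. -/
def robustCost {n : ℕ} (U : Set (Fin n → ℝ)) (x : Fin n → ℝ) : ℝ :=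
  sSup ((fun c => c ⬝ᵥ x) '' U)

/-- Optimal value of the robust problem: the minimum over `x ∈ S` of the worst-case objective. -/
def robustOpt {n : ℕ} (S U : Set (Fin n → ℝ)) : ℝ :=
  sInf (robustCost U '' S)

/-- `β = min_r max_i a_{ir}`. -/
def beta {k m : ℕ} (A : Matrix (Fin m) (Fin k) ℝ) : ℝ := ⨅ r, ⨆ i, A i r

/-- `γ = max_{i,r} a_{ir}`. -/
def gamma {k m : ℕ} (A : Matrix (Fin m) (Fin k) ℝ) : ℝ := ⨆ i, ⨆ r, A i r

/-- The smallest positive entry of the generators. -/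
def cMin {n k : ℕ} (C : Fin k → Fin n → ℝ) : ℝ := sInf {t | 0 < t ∧ ∃ r j, C r j = t}

/-- The largest entry of the generators. -/
def cMax {n k : ℕ} (C : Fin k → Fin n → ℝ) : ℝ := ⨆ r, ⨆ j, C r j

/-- `Q` is the feasible set of a linear programming relaxation over `ℝ₊ⁿ` of the problem with
solution set `S`: a polyhedron in the nonnegative orthant that contains `S`. -/
structure IsLPRelaxation {n : ℕ} (S Q : Set (Fin n → ℝ)) : Prop where
  subset : S ⊆ Q
  polyhedron : ∃ (p : ℕ) (G : Matrix (Fin p) (Fin n) ℝ) (h : Fin p → ℝ),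
    Q = {x | 0 ≤ x ∧ h ≤ G.mulVec x}

/-! ## Negatively correlated randomized rounding -/

/-- The expectation of `cᵀ y` for a random vector `y` with (discrete) law `p`. -/
def expectedCost {n : ℕ} (p : PMF (Fin n → ℝ)) (c : Fin n → ℝ) : ℝ :=
  ∑' y, (p y).toReal * (c ⬝ᵥ y)

/-- `p` is the law of an `α`-approximate negatively correlated randomized rounding of `x`. -/
structure IsANCRR {n : ℕ} (α : ℝ) (S : Set (Fin n → ℝ)) (x : Fin n → ℝ)
    (p : PMF (Fin n → ℝ)) : Prop where
  mem : p.support ⊆ S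
  expectation : ∀ c : Fin n → ℝ, 0 ≤ c → expectedCost p c ≤ α * (c ⬝ᵥ x)
  negCorrelated : ∀ T : Finset (Fin n),
    p.toOuterMeasure {y | ∀ i ∈ T, y i = 1} ≤ ∏ i ∈ T, p.toOuterMeasure {y | y i = 1}

/-- An `α`-ANCRR integrality gap verifier: it rounds every `x ∈ Q`. Nothing is known about its
answers outside `Q`. -/
def IsANCRRVerifier {n : ℕ} (α : ℝ) (S Q : Set (Fin n → ℝ))
    (V : (Fin n → ℝ) → PMF (Fin n → ℝ)) : Prop :=
  ∀ x ∈ Q, IsANCRR α S x (V x)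

/-! ## Linear programs over the relaxation -/

/-- A linear program over the relaxation `Q`, with additional variables `y ≥ 0` and additional
constraints: minimize `objXᵀ x + objYᵀ y` over `x ∈ Q`, `y ≥ 0` with `MX x + MY y ≥ rhs`. -/
structure RelaxLP (n : ℕ) where
  rows : ℕ
  aux : ℕ
  MX : Matrix (Fin rows) (Fin n) ℝ
  MY : Matrix (Fin rows) (Fin aux) ℝ
  rhs : Fin rows → ℝ
  objX : Fin n → ℝ
  objY : Fin aux → ℝ

/-- The points of the linear program are pairs `(x, y)`. -/
def RelaxLP.feasible {n : ℕ} (q : RelaxLP n) (Q : Set (Fin n → ℝ)) :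
    Set ((Fin n → ℝ) × (Fin q.aux → ℝ)) :=
  {z | z.1 ∈ Q ∧ 0 ≤ z.2 ∧ q.rhs ≤ q.MX.mulVec z.1 + q.MY.mulVec z.2}

def RelaxLP.value {n : ℕ} (q : RelaxLP n) (z : (Fin n → ℝ) × (Fin q.aux → ℝ)) : ℝ :=
  q.objX ⬝ᵥ z.1 + q.objY ⬝ᵥ z.2

def RelaxLP.IsOptimal {n : ℕ} (q : RelaxLP n) (Q : Set (Fin n → ℝ))
    (z : (Fin n → ℝ) × (Fin q.aux → ℝ)) : Prop :=
  z ∈ q.feasible Q ∧ ∀ w ∈ q.feasible Q, q.value z ≤ q.value w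

/-- A solver of linear programs over `Q`: it returns some optimal solution (no matter which one)
if there is one, and reports `none` if there is none. -/
def IsLPSolver {n : ℕ} (Q : Set (Fin n → ℝ))
    (solve : (q : RelaxLP n) → Option ((Fin n → ℝ) × (Fin q.aux → ℝ))) : Prop :=
  ∀ q, (∀ z, solve q = some z → q.IsOptimal Q z) ∧ (solve q = none → ∀ z, ¬ q.IsOptimal Q z)

/-! ## The machine model

A real random access machine in structured form. A program is a finite text that does not depend
on the input. It has registers for natural numbers (indices) and two-dimensional arrays of reals
(a vector is row `0` of an array), exact rational arithmetic and comparisons on reals, bounded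
loops, and two kinds of subroutine calls: linear programs over `Q`, and the verifier. The set
`S` is accessible only through the verifier, and `Q` only through linear programs. -/

/-- Index expressions. -/
inductive NExp : Type
  | const (a : ℕ)
  | reg (v : ℕ)
  | add (e f : NExp)

/-- Real expressions; `read a i j` is the entry in row `i` and column `j` of array `a`. -/
inductive RExp : Type
  | const (q : ℚ)
  | read (a : ℕ) (i j : NExp)
  | add (e f : RExp)
  | sub (e f : RExp)
  | mul (e f : RExp)
  | div (e f : RExp)

/-- Tests. -/
inductive Test : Type
  | natLe (e f : NExp)
  | realLe (e f : RExp)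

/-- Programs. -/
inductive Prog : Type
  | skip
  /-- Assign to a register. -/
  | setReg (v : ℕ) (e : NExp)
  /-- Assign to the entry in row `i`, column `j` of array `a`. -/
  | write (a : ℕ) (i j : NExp) (e : RExp)
  | seq (P P' : Prog)
  | cond (t : Test) (P P' : Prog)
  /-- Run `P` with register `v` set to `0, 1, …, e - 1`, where `e` is evaluated once. -/
  | loop (v : ℕ) (e : NExp) (P : Prog)
  /-- Solve the linear program over `Q` whose data are stored in the named arrays. Set register
  `flag` to `1` and store an optimal solution in arrays `outX`, `outY` if there is one; otherwise
  set `flag` to `0`. -/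
  | solveLP (rows aux : NExp) (MX MY rhs objX objY outX outY flag : ℕ)
  /-- Call the verifier on the vector in array `src`, store its random answer in array `dst`. -/
  | callVerifier (src dst : ℕ)

/-- Machine states, with counters for the elementary steps and for the verifier calls so far. -/
structure State : Type where
  reg : ℕ → ℕ
  arr : ℕ → ℕ → ℕ → ℝ
  steps : ℕ
  calls : ℕ

namespace State

/-- Spend `t` steps. -/
def tick (t : ℕ) (s : State) : State := { s with steps := s.steps + t }

def setReg (v a : ℕ) (s : State) : State := { s with reg := Function.update s.reg v a }

def setEntry (a i j : ℕ) (t : ℝ) (s : State) : State :=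
  let M := Function.update (s.arr a) i (Function.update (s.arr a i) j t)
  { s with arr := Function.update s.arr a M }

/-- The vector of length `d` stored in array `a`. -/
def vec (s : State) (a d : ℕ) : Fin d → ℝ := fun j => s.arr a 0 j

/-- The matrix with `l` rows and `d` columns stored in array `a`. -/
def mat (s : State) (a l d : ℕ) : Matrix (Fin l) (Fin d) ℝ := Matrix.of fun i j => s.arr a i j

/-- Store a vector in array `a`. -/
def setVec {d : ℕ} (a : ℕ) (x : Fin d → ℝ) (s : State) : State :=
  let M := Function.update (s.arr a) 0 (fun j => if h : j < d then x ⟨j, h⟩ else 0)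
  { s with arr := Function.update s.arr a M }

end State

def NExp.eval (s : State) : NExp → ℕ
  | const a => a
  | reg v => s.reg v
  | add e f => e.eval s + f.eval s

def RExp.eval (s : State) : RExp → ℝ
  | const q => (q : ℝ)
  | read a i j => s.arr a (i.eval s) (j.eval s)
  | add e f => e.eval s + f.eval s
  | sub e f => e.eval s - f.eval s
  | mul e f => e.eval s * f.eval s
  | div e f => e.eval s / f.eval s

def Test.holds (s : State) : Test → Prop
  | natLe e f => e.eval s ≤ f.eval s
  | realLe e f => e.eval s ≤ f.eval s

/-- The two subroutines available to a program. -/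
structure Oracles (n : ℕ) where
  solve : (q : RelaxLP n) → Option ((Fin n → ℝ) × (Fin q.aux → ℝ))
  round : (Fin n → ℝ) → PMF (Fin n → ℝ)

/-- The law of the final state of a program started in state `s`; different verifier calls use
independent randomness. A linear program is charged for its size, a verifier call for the length
of its argument. -/
def Prog.run {n : ℕ} (O : Oracles n) : Prog → State → PMF State
  | skip, s => PMF.pure s
  | setReg v e, s => PMF.pure ((s.setReg v (e.eval s)).tick 1)
  | write a i j e, s => PMF.pure ((s.setEntry a (i.eval s) (j.eval s) (e.eval s)).tick 1)
  | seq P P', s => (P.run O s).bind fun s' => P'.run O s'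
  | cond t P P', s =>
      open scoped Classical in
      if t.holds s then P.run O (s.tick 1) else P'.run O (s.tick 1)
  | loop v e P, s =>
      (List.range (e.eval s)).foldl
        (fun (μ : PMF State) (i : ℕ) => μ.bind fun s' => P.run O ((s'.setReg v i).tick 1))
        (PMF.pure (s.tick 1))
  | solveLP rows aux MX MY rhs objX objY outX outY flag, s =>
      let l := rows.eval s
      let d := aux.eval s
      let q : RelaxLP n :=
        { rows := l
          aux := d
          MX := s.mat MX l n
          MY := s.mat MY l d
          rhs := s.vec rhs l
          objX := s.vec objX n
          objY := s.vec objY d }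
      let s' := s.tick ((l + 1) * (n + d + 1))
      match O.solve q with
      | some z => PMF.pure (((s'.setVec outX z.1).setVec outY z.2).setReg flag 1)
      | none => PMF.pure (s'.setReg flag 0)
  | callVerifier src dst, s =>
      (O.round (s.vec src n)).bind fun y =>
        PMF.pure { (s.setVec dst y).tick (n + 1) with calls := s.calls + 1 }

/-- The initial state: registers `0`, `1`, `2` hold `n`, `k`, `m`; arrays `0`, `1`, `2`, `3` hold
`c⁰`, the generators (one per row), `A` and `b`; everything else is zero. -/
def initState {n k m : ℕ} (c0 : Fin n → ℝ) (C : Fin k → Fin n → ℝ)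
    (A : Matrix (Fin m) (Fin k) ℝ) (b : Fin m → ℝ) : State where
  reg
    | 0 => n
    | 1 => k
    | 2 => m
    | _ => 0
  arr
    | 0 => fun i j => if h : i = 0 ∧ j < n then c0 ⟨j, h.2⟩ else 0
    | 1 => fun i j => if h : i < k ∧ j < n then C ⟨i, h.1⟩ ⟨j, h.2⟩ else 0
    | 2 => fun i j => if h : i < m ∧ j < k then A ⟨i, h.1⟩ ⟨j, h.2⟩ else 0
    | 3 => fun i j => if h : i = 0 ∧ j < m then b ⟨j, h.2⟩ else 0
    | _ => fun _ _ => 0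
  steps := 0
  calls := 0

/-- The output of a program is the vector in array `4`. -/
def State.output (s : State) (n : ℕ) : Fin n → ℝ := s.vec 4 n

/-- On this run, `P` is `ρ`-robust with probability at least `1 - η`: with that probability the
output satisfies `cᵀ x̂ ≤ ρ · OPT_R` for all `c` in the uncertainty set simultaneously. -/
def IsRobustWithProb {n : ℕ} (S U : Set (Fin n → ℝ)) (μ : PMF State) (ρ η : ℝ) : Prop :=
  1 - η ≤ (μ.toOuterMeasure {s | ∀ c ∈ U, c ⬝ᵥ s.output n ≤ ρ * robustOpt S U}).toReal

end

end RobustDO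

open RobustDO

/-! Write F(y) for the maximum of δᵀy over the perturbation set, which is bounded because every
column of A has a positive entry. The worst-case cost of x is c⁰ᵀx + F(Cx), where Cx collects the
values cʳᵀx. LP duality replaces F by a minimum (`exists_dual`), so minimizing the worst-case cost
over Q is a single linear program. The question is what rounding its solution x costs.

Let κ = max(k, 2). Negative correlation gives a Chernoff bound for each generator: cʳᵀŷ ≤ 2α cʳᵀx +
3 c_max log κ, outside an event of probability κ⁻³. The additive term is harmless if cʳᵀx is at
least τ = 3 c_max log κ / ρ, for then it is at most ρ cʳᵀx. For the remaining generators δ_r is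
replaced by its separate maximum u_r = F(e_r). They merge with c⁰ into one fixed cost vector, for
which Markov's inequality suffices, and contribute at most kτ max u_r to its value at x.

To compare u_r with OPT_R, take an optimal x* in S and let D be the largest u_r among the generators
with cʳᵀx* > 0. Since x* is a 0/1 vector, cʳᵀx* ≥ c_min, so c_min D ≤ OPT_R. The program that forces
cʳᵀx ≤ 0 whenever u_r > D therefore still has value at most OPT_R (`exists_guess`), and the small
generators contribute at most kτD. Balancing gives ρ² ≥ k log κ · c_max / c_min, and one rounding
costs at most 18αρ OPT_R with probability at least 1/2 (`toOuterMeasure_bad_le_half`). The factor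
γ/β ≥ 1 of the theorem only weakens this.

D is one of k + 1 known numbers, counting 0 for the case of no active generator. All are tried, with
L roundings each. Costs are computed exactly by linear programs and the best solution is kept, so
wrong guesses do no harm and failure has probability at most 2⁻ᴸ (`algorithm_fail_le`). Running time
is read off the program text by `ensures_cost`. -/

namespace RobustDO

/-! ### Polyhedra and Fourier–Motzkin elimination -/

/-- Finite intersections of closed half-spaces. -/
def IsHPoly {E : Type*} [AddCommGroup E] [Module ℝ E] (s : Set E) : Prop :=
  ∃ (ι : Type) (_ : Finite ι) (f : ι → E →ₗ[ℝ] ℝ) (h : ι → ℝ), s = {x | ∀ i, f i x ≤ h i}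

namespace IsHPoly

variable {E F : Type*} [AddCommGroup E] [Module ℝ E] [AddCommGroup F] [Module ℝ F]

lemma halfspace (f : E →ₗ[ℝ] ℝ) (h : ℝ) : IsHPoly {x | f x ≤ h} :=
  ⟨Unit, inferInstance, fun _ => f, fun _ => h, by ext; simp⟩

lemma iInter {κ : Type} [Finite κ] {s : κ → Set E} (hs : ∀ j, IsHPoly (s j)) :
    IsHPoly {x | ∀ j, x ∈ s j} := by
  choose ι hι f h hs using hs
  refine ⟨Σ j, ι j, inferInstance, fun p => f p.1 p.2, fun p => h p.1 p.2, ?_⟩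
  ext x
  simp [hs, Sigma.forall]

lemma inter {s t : Set E} (hs : IsHPoly s) (ht : IsHPoly t) : IsHPoly (s ∩ t) := by
  have := iInter (κ := Bool) (s := fun j => if j then s else t) (by simp [hs, ht])
  convert this using 1
  ext x
  simp [and_comm]

lemma preimage {s : Set F} (hs : IsHPoly s) (L : E →ₗ[ℝ] F) : IsHPoly (L ⁻¹' s) := by
  obtain ⟨ι, hι, f, h, rfl⟩ := hs
  exact ⟨ι, hι, fun i => f i ∘ₗ L, h, by ext; simp⟩

end IsHPoly

lemma exists_between_finite {ι κ : Type*} [Finite ι] [Finite κ] (l : ι → ℝ) (u : κ → ℝ)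
    (h : ∀ i j, l i ≤ u j) : ∃ t, (∀ i, l i ≤ t) ∧ ∀ j, t ≤ u j := by
  rcases isEmpty_or_nonempty κ with hκ | hκ
  · obtain ⟨t, ht⟩ := (Set.finite_range l).bddAbove
    exact ⟨t, fun i => ht ⟨i, rfl⟩, fun j => hκ.elim j⟩
  · obtain ⟨j, hj⟩ := Finite.exists_min u
    exact ⟨u j, fun i => h i j, hj⟩

namespace IsHPoly

variable {E F : Type*} [AddCommGroup E] [Module ℝ E] [AddCommGroup F] [Module ℝ F]

/-- Fourier–Motzkin elimination of one variable. -/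
lemma proj_real {s : Set (E × ℝ)} (hs : IsHPoly s) : IsHPoly {x | ∃ t, (x, t) ∈ s} := by
  obtain ⟨ι, hι, f, h, rfl⟩ := hs
  let a : ι → ℝ := fun i => f i (0, 1)
  let g : ι → E →ₗ[ℝ] ℝ := fun i => f i ∘ₗ LinearMap.inl ℝ E ℝ
  have hf : ∀ i x t, f i (x, t) = g i x + t * a i := by
    intro i x t
    have : ((x, t) : E × ℝ) = (x, 0) + t • (0, 1) := by simp
    rw [this, map_add, map_smul]
    simp [g, a]
  -- Constraints not involving t survive. A positive coefficient bounds t above, a negative one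
  -- below, and each such pair yields the condition that the lower bound not exceed the upper one.
  refine ⟨{i // a i = 0} ⊕ ({i // 0 < a i} × {i // a i < 0}), inferInstance,
    Sum.elim (fun i => g i) (fun p => (a p.1)⁻¹ • g p.1 - (a p.2)⁻¹ • g p.2),
    Sum.elim (fun i => h i) (fun p => (a p.1)⁻¹ * h p.1 - (a p.2)⁻¹ * h p.2), ?_⟩
  have hup : ∀ i x t, 0 < a i → (f i (x, t) ≤ h i ↔ t ≤ (a i)⁻¹ * (h i - g i x)) := by
    intro i x t hi
    rw [hf, inv_mul_eq_div, le_div_iff₀ hi]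
    constructor <;> intro <;> linarith
  have hlo : ∀ i x t, a i < 0 → (f i (x, t) ≤ h i ↔ (a i)⁻¹ * (h i - g i x) ≤ t) := by
    intro i x t hi
    rw [hf, inv_mul_eq_div, div_le_iff_of_neg hi]
    constructor <;> intro <;> linarith
  ext x
  simp only [Set.mem_ofPred_eq, Sum.forall, Sum.elim_inl, Sum.elim_inr, Subtype.forall,
    Prod.forall, LinearMap.sub_apply, LinearMap.smul_apply, smul_eq_mul]
  constructor
  · rintro ⟨t, ht⟩
    refine ⟨fun i hi => by simpa [hf, hi] using ht i, fun p hp q hq => ?_⟩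
    have h1 := (hup p x t hp).1 (ht p)
    have h2 := (hlo q x t hq).1 (ht q)
    linarith
  · rintro ⟨h0, h1⟩
    obtain ⟨t, htl, htu⟩ := exists_between_finite
      (fun q : {i // a i < 0} => (a q)⁻¹ * (h q - g q x))
      (fun p : {i // 0 < a i} => (a p)⁻¹ * (h p - g p x))
      (fun q p => by have := h1 p p.2 q q.2; linarith)
    refine ⟨t, fun i => ?_⟩
    rcases lt_trichotomy (a i) 0 with hi | hi | hi
    · exact (hlo i x t hi).2 (htl ⟨i, hi⟩)
    · simpa [hf, hi] using h0 i hi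
    · exact (hup i x t hi).2 (htu ⟨i, hi⟩)

lemma proj_fin (d : ℕ) : ∀ {s : Set (E × (Fin d → ℝ))}, IsHPoly s →
    IsHPoly {x | ∃ w, (x, w) ∈ s} := by
  induction d with
  | zero =>
    intro s hs
    convert hs.preimage (LinearMap.inl ℝ E (Fin 0 → ℝ)) using 1
    ext x
    constructor
    · rintro ⟨w, hw⟩
      rwa [Subsingleton.elim w 0] at hw
    · exact fun h => ⟨0, h⟩
  | succ d ih =>
    intro s hs
    let L : ((E × (Fin d → ℝ)) × ℝ) →ₗ[ℝ] E × (Fin (d + 1) → ℝ) :=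
      { toFun := fun p => (p.1.1, Fin.cons p.2 p.1.2)
        map_add' := fun p q => by
          ext i
          · rfl
          · refine Fin.cases ?_ (fun j => ?_) i <;> simp
        map_smul' := fun c p => by
          ext i
          · rfl
          · refine Fin.cases ?_ (fun j => ?_) i <;> simp }
    have := ih (hs.preimage L).proj_real
    convert this using 1
    ext x
    constructor
    · rintro ⟨w, hw⟩
      exact ⟨Fin.tail w, w 0, by simpa [L] using hw⟩
    · rintro ⟨w, t, h⟩
      exact ⟨_, h⟩

/-- Projections of polyhedra are polyhedra. -/
lemma proj [FiniteDimensional ℝ F] {s : Set (E × F)} (hs : IsHPoly s) :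
    IsHPoly {x | ∃ w, (x, w) ∈ s} := by
  let e := (Module.finBasis ℝ F).equivFun
  have := (hs.preimage ((LinearMap.id (M := E)).prodMap e.symm.toLinearMap)).proj_fin
  convert this using 1
  ext x
  constructor
  · rintro ⟨w, hw⟩
    exact ⟨e w, by simpa using hw⟩
  · rintro ⟨w, hw⟩
    exact ⟨e.symm w, by simpa using hw⟩

lemma isClosed {E : Type*} [NormedAddCommGroup E] [NormedSpace ℝ E] [FiniteDimensional ℝ E]
    {s : Set E} (hs : IsHPoly s) : IsClosed s := by
  obtain ⟨ι, hι, f, h, rfl⟩ := hs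
  rw [Set.ofPred_forall]
  exact isClosed_iInter fun i =>
    isClosed_le (f i).continuous_of_finiteDimensional continuous_const

/-- A linear function that is bounded below on a nonempty polyhedron attains its minimum. -/
lemma exists_isMinOn [FiniteDimensional ℝ F] {s : Set F} (hs : IsHPoly s) (hne : s.Nonempty)
    (φ : F →ₗ[ℝ] ℝ) {B : ℝ} (hB : ∀ z ∈ s, B ≤ φ z) : ∃ z ∈ s, ∀ w ∈ s, φ z ≤ φ w := by
  -- The attained values are the projection of {(v, z) : z ∈ s, v = φ z}, the equation being split
  -- into two inequalities. They form a closed set, which contains its infimum.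
  have hval : IsHPoly {v : ℝ | ∃ z, (v, z) ∈
      ((LinearMap.snd ℝ ℝ F) ⁻¹' s ∩ {p : ℝ × F | (φ ∘ₗ LinearMap.snd ℝ ℝ F -
        LinearMap.fst ℝ ℝ F) p ≤ 0}) ∩ {p : ℝ × F | (LinearMap.fst ℝ ℝ F -
        φ ∘ₗ LinearMap.snd ℝ ℝ F) p ≤ 0}} :=
    (((hs.preimage _).inter (halfspace _ _)).inter (halfspace _ _)).proj
  have heq : {v : ℝ | ∃ z, (v, z) ∈
      ((LinearMap.snd ℝ ℝ F) ⁻¹' s ∩ {p : ℝ × F | (φ ∘ₗ LinearMap.snd ℝ ℝ F -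
        LinearMap.fst ℝ ℝ F) p ≤ 0}) ∩ {p : ℝ × F | (LinearMap.fst ℝ ℝ F -
        φ ∘ₗ LinearMap.snd ℝ ℝ F) p ≤ 0}} = φ '' s := by
    ext v
    constructor
    · rintro ⟨z, ⟨hz, h1⟩, h2⟩
      simp at hz h1 h2
      exact ⟨z, hz, le_antisymm h1 h2⟩
    · rintro ⟨z, hz, rfl⟩
      exact ⟨z, by simpa using hz⟩
  rw [heq] at hval
  have hbdd : BddBelow (φ '' s) := ⟨B, by rintro _ ⟨z, hz, rfl⟩; exact hB z hz⟩
  obtain ⟨z, hz, hzeq⟩ := hval.isClosed.csInf_mem (hne.image φ) hbdd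
  exact ⟨z, hz, fun w hw => hzeq ▸ csInf_le hbdd ⟨w, hw, rfl⟩⟩

end IsHPoly

/-- A vector inequality between linear maps describes a polyhedron. -/
lemma isHPoly_le {E : Type*} [AddCommGroup E] [Module ℝ E] {d : ℕ} (h : Fin d → ℝ)
    (L : E →ₗ[ℝ] (Fin d → ℝ)) : IsHPoly {x | h ≤ L x} := by
  have := IsHPoly.iInter (fun i : Fin d => IsHPoly.halfspace (-(LinearMap.proj i ∘ₗ L)) (-h i))
  convert this using 1
  ext x
  simp [Pi.le_def]

lemma IsLPRelaxation.isHPoly {n : ℕ} {S Q : Set (Fin n → ℝ)} (h : IsLPRelaxation S Q) :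
    IsHPoly Q := by
  obtain ⟨p, G, r, rfl⟩ := h.polyhedron
  exact (isHPoly_le 0 LinearMap.id).inter (isHPoly_le r G.mulVecLin)

/-- A feasible linear program whose values are bounded below has an optimal solution. -/
lemma RelaxLP.exists_isOptimal {n : ℕ} {Q : Set (Fin n → ℝ)} (hQ : IsHPoly Q) (q : RelaxLP n)
    (hne : (q.feasible Q).Nonempty) {B : ℝ} (hB : ∀ z ∈ q.feasible Q, B ≤ q.value z) :
    ∃ z, q.IsOptimal Q z := by
  have hfeas : IsHPoly (q.feasible Q) := by
    have := ((hQ.preimage (LinearMap.fst ℝ (Fin n → ℝ) (Fin q.aux → ℝ))).inter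
      (isHPoly_le 0 (LinearMap.snd ℝ (Fin n → ℝ) (Fin q.aux → ℝ)))).inter
      (isHPoly_le q.rhs (q.MX.mulVecLin ∘ₗ LinearMap.fst ℝ (Fin n → ℝ) (Fin q.aux → ℝ) +
        q.MY.mulVecLin ∘ₗ LinearMap.snd ℝ (Fin n → ℝ) (Fin q.aux → ℝ)))
    convert this using 1
    ext z
    simp [RelaxLP.feasible, and_assoc]
  obtain ⟨z, hz, hmin⟩ := hfeas.exists_isMinOn hne
    (dotProductBilin ℝ ℝ q.objX ∘ₗ LinearMap.fst ℝ (Fin n → ℝ) (Fin q.aux → ℝ) +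
      dotProductBilin ℝ ℝ q.objY ∘ₗ LinearMap.snd ℝ (Fin n → ℝ) (Fin q.aux → ℝ))
    (B := B) hB
  exact ⟨z, hz, hmin⟩

/-! ### The worst case over the perturbation set and its dual -/

noncomputable section

/-- The maximum of `δᵀ y` over the perturbation set. -/
def worstCase {k m : ℕ} (A : Matrix (Fin m) (Fin k) ℝ) (b : Fin m → ℝ) (y : Fin k → ℝ) : ℝ :=
  sSup ((fun δ => δ ⬝ᵥ y) '' perturbations A b)

end

section WorstCase

variable {k m : ℕ} {A : Matrix (Fin m) (Fin k) ℝ} {b : Fin m → ℝ}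

lemma exists_pos_of_beta_pos (hβ : 0 < beta A) (r : Fin k) : ∃ i, 0 < A i r := by
  by_contra! h
  have h1 : beta A ≤ ⨆ i, A i r := ciInf_le (Set.finite_range _).bddBelow r
  have h2 : ⨆ i, A i r ≤ 0 := Real.iSup_nonpos h
  linarith

lemma beta_le_gamma (hA : ∀ i r, 0 ≤ A i r) (r : Fin k) : beta A ≤ gamma A := by
  have h1 : beta A ≤ ⨆ i, A i r := ciInf_le (Set.finite_range _).bddBelow r
  refine h1.trans (Real.iSup_le (fun i => ?_) (Real.iSup_nonneg fun i => Real.iSup_nonneg (hA i)))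
  exact (le_ciSup (f := fun r => A i r) (Set.finite_range _).bddAbove r).trans
    (le_ciSup (f := fun i => ⨆ r, A i r) (Set.finite_range _).bddAbove i)

lemma zero_mem_perturbations (hb : 0 ≤ b) : (0 : Fin k → ℝ) ∈ perturbations A b :=
  ⟨le_rfl, by simpa using hb⟩

/-- As A and δ are nonnegative, one row with a positive entry in column r already bounds δ r. -/
lemma exists_bound_perturbations (hA : ∀ i r, 0 ≤ A i r) (hp : ∀ r, ∃ i, 0 < A i r) :
    ∃ M : Fin k → ℝ, ∀ δ ∈ perturbations A b, ∀ r, δ r ≤ M r := by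
  choose i hi using hp
  refine ⟨fun r => b (i r) / A (i r) r, fun δ hδ r => ?_⟩
  rw [le_div_iff₀ (hi r)]
  refine le_trans ?_ (hδ.2 (i r))
  rw [mul_comm]
  exact Finset.single_le_sum (f := fun r' => A (i r) r' * δ r')
    (fun r' _ => mul_nonneg (hA _ _) (hδ.1 r')) (Finset.mem_univ r)

lemma bddAbove_perturbations (hA : ∀ i r, 0 ≤ A i r) (hp : ∀ r, ∃ i, 0 < A i r)
    (y : Fin k → ℝ) : BddAbove ((fun δ => δ ⬝ᵥ y) '' perturbations A b) := by
  obtain ⟨M, hM⟩ := exists_bound_perturbations (b := b) hA hp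
  refine ⟨∑ r, M r * |y r|, ?_⟩
  rintro _ ⟨δ, hδ, rfl⟩
  refine Finset.sum_le_sum fun r _ => ?_
  calc δ r * y r ≤ δ r * |y r| := mul_le_mul_of_nonneg_left (le_abs_self _) (hδ.1 r)
    _ ≤ M r * |y r| := mul_le_mul_of_nonneg_right (hM δ hδ r) (abs_nonneg _)

lemma le_worstCase (hA : ∀ i r, 0 ≤ A i r) (hp : ∀ r, ∃ i, 0 < A i r) {δ : Fin k → ℝ}
    (hδ : δ ∈ perturbations A b) (y : Fin k → ℝ) : δ ⬝ᵥ y ≤ worstCase A b y :=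
  le_csSup (bddAbove_perturbations hA hp y) ⟨δ, hδ, rfl⟩

lemma worstCase_le (hb : 0 ≤ b) {y : Fin k → ℝ} {B : ℝ}
    (h : ∀ δ ∈ perturbations A b, δ ⬝ᵥ y ≤ B) : worstCase A b y ≤ B :=
  csSup_le ⟨_, 0, zero_mem_perturbations hb, rfl⟩ (by rintro _ ⟨δ, hδ, rfl⟩; exact h δ hδ)

lemma worstCase_nonneg (hA : ∀ i r, 0 ≤ A i r) (hp : ∀ r, ∃ i, 0 < A i r) (hb : 0 ≤ b)
    (y : Fin k → ℝ) : 0 ≤ worstCase A b y := by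
  simpa using le_worstCase hA hp (zero_mem_perturbations hb) y

lemma le_worstCase_single (hA : ∀ i r, 0 ≤ A i r) (hp : ∀ r, ∃ i, 0 < A i r) {δ : Fin k → ℝ}
    (hδ : δ ∈ perturbations A b) (r : Fin k) : δ r ≤ worstCase A b (Pi.single r 1) := by
  simpa using le_worstCase hA hp hδ (Pi.single r 1)

/-- A lower bound on one coordinate gives a lower bound on the worst case. -/
lemma mul_worstCase_single_le (hA : ∀ i r, 0 ≤ A i r) (hp : ∀ r, ∃ i, 0 < A i r) (hb : 0 ≤ b)
    {y : Fin k → ℝ} (hy : 0 ≤ y) {r : Fin k} {t : ℝ} (ht : 0 < t) (hr : t ≤ y r) :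
    t * worstCase A b (Pi.single r 1) ≤ worstCase A b y := by
  rw [mul_comm, ← le_div_iff₀ ht]
  refine worstCase_le hb fun δ hδ => ?_
  rw [dotProduct_single, mul_one, le_div_iff₀ ht]
  refine le_trans (mul_le_mul_of_nonneg_left hr (hδ.1 r)) (le_trans ?_ (le_worstCase hA hp hδ y))
  exact Finset.single_le_sum (f := fun r => δ r * y r)
    (fun r _ => mul_nonneg (hδ.1 r) (hy r)) (Finset.mem_univ r)

/-- Weak duality for the inner maximization. -/
lemma dotProduct_le_of_dual {δ y : Fin k → ℝ} {z : Fin m → ℝ} (hδ : δ ∈ perturbations A b)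
    (hz : 0 ≤ z) (hyz : y ≤ (Matrix.transpose A).mulVec z) : δ ⬝ᵥ y ≤ b ⬝ᵥ z := by
  calc δ ⬝ᵥ y ≤ δ ⬝ᵥ (Matrix.transpose A).mulVec z :=
        dotProduct_le_dotProduct_of_nonneg_left hyz hδ.1
    _ = A.mulVec δ ⬝ᵥ z := by rw [Matrix.dotProduct_mulVec, Matrix.vecMul_transpose]
    _ ≤ b ⬝ᵥ z := dotProduct_le_dotProduct_of_nonneg_right hδ.2 hz

/-- The cone of upper bounds on the worst case that dual solutions certify. -/
def dualCone (A : Matrix (Fin m) (Fin k) ℝ) (b : Fin m → ℝ) :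
    PointedCone ℝ ((Fin k → ℝ) × ℝ) where
  carrier := {p | ∃ z : Fin m → ℝ, 0 ≤ z ∧ p.1 ≤ (Matrix.transpose A).mulVec z ∧ b ⬝ᵥ z ≤ p.2}
  zero_mem' := ⟨0, le_rfl, by simp, by simp⟩
  add_mem' := by
    rintro p q ⟨z, hz, h1, h2⟩ ⟨w, hw, h3, h4⟩
    refine ⟨z + w, add_nonneg hz hw, ?_, ?_⟩
    · rw [Matrix.mulVec_add]; exact add_le_add h1 h3
    · rw [dotProduct_add]; exact add_le_add h2 h4
  smul_mem' := by
    rintro ⟨c, hc⟩ p ⟨z, hz, h1, h2⟩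
    refine ⟨c • z, smul_nonneg hc hz, ?_, ?_⟩
    · rw [Matrix.mulVec_smul]; exact smul_le_smul_of_nonneg_left h1 hc
    · rw [dotProduct_smul]; exact mul_le_mul_of_nonneg_left h2 hc

/-- The separation argument needs a closed cone. This one is the image of a cone under a projection,
which in general need not be closed; it is closed here because projections of polyhedra are
polyhedra. -/
lemma isClosed_dualCone (A : Matrix (Fin m) (Fin k) ℝ) (b : Fin m → ℝ) :
    IsClosed (dualCone A b : Set ((Fin k → ℝ) × ℝ)) := by
  let π₁ := LinearMap.fst ℝ ((Fin k → ℝ) × ℝ) (Fin m → ℝ)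
  let π₂ := LinearMap.snd ℝ ((Fin k → ℝ) × ℝ) (Fin m → ℝ)
  have := ((isHPoly_le 0 π₂).inter ((isHPoly_le 0 ((Matrix.transpose A).mulVecLin ∘ₗ π₂ -
    LinearMap.fst ℝ _ _ ∘ₗ π₁)).inter (IsHPoly.halfspace (dotProductBilin ℝ ℝ b ∘ₗ π₂ -
    LinearMap.snd ℝ _ _ ∘ₗ π₁) 0))).proj.isClosed
  refine (congrArg IsClosed (Set.ext fun p => ?_)).mpr this
  refine exists_congr fun z => and_congr Iff.rfl (and_congr ?_ ?_)
  · exact sub_nonneg.symm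
  · exact sub_nonpos.symm

/-- Strong duality for the inner maximization problem. -/
lemma exists_dual (hA : ∀ i r, 0 ≤ A i r) (hp : ∀ r, ∃ i, 0 < A i r)
    (y : Fin k → ℝ) : ∃ z : Fin m → ℝ, 0 ≤ z ∧ y ≤ (Matrix.transpose A).mulVec z ∧
      b ⬝ᵥ z ≤ worstCase A b y := by
  by_contra hcon
  let K : ProperCone ℝ ((Fin k → ℝ) × ℝ) := ⟨dualCone A b, isClosed_dualCone A b⟩
  -- Separate the point from the cone and write the functional as p ↦ -uᵀp₁ + λp₂. Testing it on
  -- elements of the cone gives u ≥ 0, λ ≥ 0 and A u ≤ λ b.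
  obtain ⟨f, hf, hneg⟩ := K.hyperplane_separation_point (x₀ := (y, worstCase A b y)) hcon
  let u : Fin k → ℝ := fun r => -f (Pi.single r 1, 0)
  let lam : ℝ := f (0, 1)
  have hfeq : ∀ p : (Fin k → ℝ) × ℝ, f p = -(u ⬝ᵥ p.1) + lam * p.2 := by
    intro p
    have h1 : p = ∑ r, p.1 r • ((Pi.single r 1, 0) : (Fin k → ℝ) × ℝ) + p.2 • (0, 1) := by
      ext r
      · simp [Prod.fst_sum, Finset.sum_apply, Pi.single_apply]
      · simp [Prod.snd_sum]
    conv_lhs => rw [h1]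
    simp only [map_add, map_sum, map_smul, smul_eq_mul, u, lam, dotProduct, mul_comm]
    simp only [mul_neg, Finset.sum_neg_distrib, neg_neg]
  have hmem : ∀ p : (Fin k → ℝ) × ℝ, (∃ z : Fin m → ℝ, 0 ≤ z ∧
      p.1 ≤ (Matrix.transpose A).mulVec z ∧ b ⬝ᵥ z ≤ p.2) → 0 ≤ -(u ⬝ᵥ p.1) + lam * p.2 :=
    fun p hp => hfeq p ▸ hf p hp
  have hu : 0 ≤ u := by
    intro r
    have := hmem (-Pi.single r 1, 0) ⟨0, le_rfl, by
      simp [Pi.single_nonneg], by simp⟩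
    simpa using this
  have hlam : 0 ≤ lam := by
    have := hmem (0, 1) ⟨0, le_rfl, by simp, by simp⟩
    simpa using this
  have hAu : ∀ i, A.mulVec u i ≤ lam * b i := by
    intro i
    have := hmem ((Matrix.transpose A).mulVec (Pi.single i 1), b i)
      ⟨Pi.single i 1, by simp [Pi.single_nonneg], le_rfl, by simp⟩
    simp only [Matrix.dotProduct_mulVec, Matrix.vecMul_transpose, dotProduct_single,
      mul_one] at this
    linarith
  rw [hfeq] at hneg
  -- If λ = 0, then A u ≤ 0 forces u = 0 and nothing is separated. If λ > 0, then u / λ is a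
  -- perturbation whose value at y exceeds the worst case.
  rcases hlam.eq_or_lt with h0 | hpos
  · have hu0 : u = 0 := by
      ext r
      obtain ⟨i, hi⟩ := hp r
      have h1 := hAu i
      rw [← h0, zero_mul] at h1
      have h2 : A i r * u r ≤ A.mulVec u i := Finset.single_le_sum (f := fun r => A i r * u r)
        (fun r' _ => mul_nonneg (hA _ _) (hu r')) (Finset.mem_univ r)
      have h3 : u r ≤ 0 := by
        by_contra! h
        have := mul_pos hi h
        linarith
      exact le_antisymm h3 (hu r)
    simp [hu0, ← h0] at hneg
  · have hδ : lam⁻¹ • u ∈ perturbations A b := by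
      refine ⟨smul_nonneg (inv_nonneg.2 hlam) hu, fun i => ?_⟩
      rw [Matrix.mulVec_smul, Pi.smul_apply, smul_eq_mul, inv_mul_le_iff₀ hpos]
      exact hAu i
    have := le_worstCase hA hp hδ y
    rw [smul_dotProduct, smul_eq_mul, inv_mul_le_iff₀ hpos] at this
    dsimp only at hneg
    linarith

/-- The values `cʳᵀ x` of the generators. -/
def genValues {n k : ℕ} (C : Fin k → Fin n → ℝ) (x : Fin n → ℝ) : Fin k → ℝ := fun r => C r ⬝ᵥ x

lemma dotProduct_uncertainty {n : ℕ} (c0 : Fin n → ℝ) (C : Fin k → Fin n → ℝ) (δ : Fin k → ℝ)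
    (x : Fin n → ℝ) : (c0 + ∑ r, δ r • C r) ⬝ᵥ x = c0 ⬝ᵥ x + δ ⬝ᵥ genValues C x := by
  rw [add_dotProduct, sum_dotProduct]
  simp [dotProduct, genValues, Finset.mul_sum, mul_assoc]

lemma robustCost_eq {n : ℕ} (hA : ∀ i r, 0 ≤ A i r) (hp : ∀ r, ∃ i, 0 < A i r) (hb : 0 ≤ b)
    (c0 : Fin n → ℝ) (C : Fin k → Fin n → ℝ) (x : Fin n → ℝ) :
    robustCost (uncertaintySet c0 C A b) x = c0 ⬝ᵥ x + worstCase A b (genValues C x) := by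
  have hle : ∀ c ∈ uncertaintySet c0 C A b,
      c ⬝ᵥ x ≤ c0 ⬝ᵥ x + worstCase A b (genValues C x) := by
    rintro _ ⟨δ, hδ, rfl⟩
    rw [dotProduct_uncertainty]
    linarith [le_worstCase hA hp hδ (genValues C x)]
  apply le_antisymm
  · refine csSup_le ⟨_, _, ⟨0, zero_mem_perturbations hb, rfl⟩, rfl⟩ ?_
    rintro _ ⟨c, hc, rfl⟩
    exact hle c hc
  · rw [← le_sub_iff_add_le']
    refine worstCase_le hb fun δ hδ => ?_
    rw [le_sub_iff_add_le', ← dotProduct_uncertainty]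
    refine le_csSup ⟨c0 ⬝ᵥ x + worstCase A b (genValues C x), ?_⟩ ⟨_, ⟨δ, hδ, rfl⟩, rfl⟩
    rintro _ ⟨c, hc, rfl⟩
    exact hle c hc

lemma dotProduct_le_of_mem_uncertaintySet {n : ℕ} (hA : ∀ i r, 0 ≤ A i r)
    (hp : ∀ r, ∃ i, 0 < A i r) {c0 : Fin n → ℝ} {C : Fin k → Fin n → ℝ} {c : Fin n → ℝ}
    (hc : c ∈ uncertaintySet c0 C A b) (x : Fin n → ℝ) :
    c ⬝ᵥ x ≤ c0 ⬝ᵥ x + worstCase A b (genValues C x) := by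
  obtain ⟨δ, hδ, rfl⟩ := hc
  rw [dotProduct_uncertainty]
  linarith [le_worstCase hA hp hδ (genValues C x)]

end WorstCase

lemma finite_of_zero_one {n : ℕ} {S : Set (Fin n → ℝ)} (hS : ∀ x ∈ S, ∀ j, x j = 0 ∨ x j = 1) :
    S.Finite := by
  refine (Set.Finite.pi' (t := fun _ : Fin n => ({0, 1} : Set ℝ)) fun _ => by simp).subset ?_
  intro x hx j
  simpa using hS x hx j

lemma exists_robustOpt_eq {n : ℕ} {S : Set (Fin n → ℝ)} (hfin : S.Finite) (hne : S.Nonempty)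
    (U : Set (Fin n → ℝ)) : ∃ x ∈ S, robustOpt S U = robustCost U x := by
  obtain ⟨x, hx, h⟩ := (hne.image (robustCost U)).csInf_mem (hfin.image _)
  exact ⟨x, hx, h.symm⟩

/-! ### Smallest and largest generator entries -/

section Entries

variable {n k : ℕ} (C : Fin k → Fin n → ℝ)

lemma finite_pos_entries : {t | 0 < t ∧ ∃ r j, C r j = t}.Finite :=
  (Set.finite_range fun p : Fin k × Fin n => C p.1 p.2).subset (by
    rintro _ ⟨-, r, j, rfl⟩; exact ⟨(r, j), rfl⟩)

lemma cMin_le {r : Fin k} {j : Fin n} (h : 0 < C r j) : cMin C ≤ C r j :=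
  csInf_le (finite_pos_entries C).bddBelow ⟨h, r, j, rfl⟩

lemma cMin_pos (h : ∃ r j, 0 < C r j) : 0 < cMin C := by
  obtain ⟨r, j, h⟩ := h
  exact (Set.Nonempty.csInf_mem (s := {t | 0 < t ∧ ∃ r j, C r j = t})
    ⟨_, h, r, j, rfl⟩ (finite_pos_entries C)).1

lemma le_cMax (r : Fin k) (j : Fin n) : C r j ≤ cMax C :=
  (le_ciSup (f := fun j => C r j) (Set.finite_range _).bddAbove j).trans
    (le_ciSup (f := fun r => ⨆ j, C r j) (Set.finite_range _).bddAbove r)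

/-- Integrality of x is essential: a positive sum of entries weighted by 0 and 1 contains a whole
positive entry. A fractional x admits no such bound, so the threshold D is derived from an optimal
point of S. -/
lemma cMin_le_genValues {C : Fin k → Fin n → ℝ} (hC : 0 ≤ C) {x : Fin n → ℝ}
    (hx : ∀ j, x j = 0 ∨ x j = 1) {r : Fin k} (h : 0 < genValues C x r) :
    cMin C ≤ genValues C x r := by
  have hx0 : ∀ j, 0 ≤ x j := fun j => by rcases hx j with h | h <;> simp [h]
  obtain ⟨j, -, hj⟩ := Finset.exists_lt_of_sum_lt (s := Finset.univ) (f := fun _ => (0 : ℝ))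
    (g := fun j => C r j * x j) (by simpa [genValues, dotProduct] using h)
  rcases hx j with h0 | h1
  · simp [h0] at hj
  · rw [h1, mul_one] at hj
    refine (cMin_le C hj).trans ?_
    have := Finset.single_le_sum (f := fun j => C r j * x j)
      (fun j _ => mul_nonneg (hC r j) (hx0 j)) (Finset.mem_univ j)
    simpa [h1, genValues, dotProduct] using this

end Entries

/-! ### Tail bounds for finitely supported weights -/

section Weights

variable {n : ℕ} {Y : Finset (Fin n → ℝ)} {w : (Fin n → ℝ) → ℝ}

/-- The Chernoff moment bound for negatively correlated `0/1` vectors. -/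
lemma sum_exp_le (hw : ∀ y, 0 ≤ w y)
    (h01 : ∀ y ∈ Y, ∀ j, y j = 0 ∨ y j = 1)
    (hneg : ∀ T : Finset (Fin n),
      ∑ y ∈ Y, w y * ∏ j ∈ T, y j ≤ ∏ j ∈ T, ∑ y ∈ Y, w y * y j)
    {c : Fin n → ℝ} (hc0 : 0 ≤ c) (hc1 : c ≤ 1) :
    ∑ y ∈ Y, w y * Real.exp (c ⬝ᵥ y) ≤ Real.exp (2 * ∑ y ∈ Y, w y * (c ⬝ᵥ y)) := by
  let e : Fin n → ℝ := fun j => Real.exp (c j) - 1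
  have he0 : ∀ j, 0 ≤ e j := fun j => sub_nonneg.2 (Real.one_le_exp (hc0 j))
  -- This is where c ≤ 1 enters, and the source of the factor 2 in front of the mean.
  have he2 : ∀ j, e j ≤ 2 * c j := by
    intro j
    have habs : |c j| = c j := abs_of_nonneg (hc0 j)
    have := Real.abs_exp_sub_one_le (x := c j) (by rw [habs]; exact hc1 j)
    rw [habs] at this
    exact (le_abs_self _).trans this
  let P : Fin n → ℝ := fun j => ∑ y ∈ Y, w y * y j
  have hP : ∀ j, 0 ≤ P j := fun j => Finset.sum_nonneg fun y hy => mul_nonneg (hw y) (by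
    rcases h01 y hy j with h | h <;> simp [h])
  -- For y j ∈ {0, 1}, exp (c j * y j) = 1 + e j * y j. Expanding the product gives a nonnegative
  -- combination of monomials; negative correlation bounds the mean of each, and the expansion is
  -- then folded back.
  have hexp : ∀ y ∈ Y, Real.exp (c ⬝ᵥ y) =
      ∑ T ∈ (Finset.univ : Finset (Fin n)).powerset, (∏ j ∈ T, e j) * ∏ j ∈ T, y j := by
    intro y hy
    simp_rw [← Finset.prod_mul_distrib]
    rw [← Finset.prod_one_add, dotProduct, Real.exp_sum]
    refine Finset.prod_congr rfl fun j _ => ?_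
    rcases h01 y hy j with h | h <;> simp [h, e]
  have hlin : ∑ j, c j * P j = ∑ y ∈ Y, w y * (c ⬝ᵥ y) := by
    simp only [P, dotProduct, Finset.mul_sum]
    rw [Finset.sum_comm]
    exact Finset.sum_congr rfl fun y _ => Finset.sum_congr rfl fun j _ => by ring
  calc ∑ y ∈ Y, w y * Real.exp (c ⬝ᵥ y)
      = ∑ y ∈ Y, ∑ T ∈ (Finset.univ : Finset (Fin n)).powerset,
          (∏ j ∈ T, e j) * (w y * ∏ j ∈ T, y j) := by
        refine Finset.sum_congr rfl fun y hy => ?_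
        rw [hexp y hy, Finset.mul_sum]
        exact Finset.sum_congr rfl fun T _ => by ring
    _ = ∑ T ∈ (Finset.univ : Finset (Fin n)).powerset,
          (∏ j ∈ T, e j) * ∑ y ∈ Y, w y * ∏ j ∈ T, y j := by
        rw [Finset.sum_comm]
        simp_rw [Finset.mul_sum]
    _ ≤ ∑ T ∈ (Finset.univ : Finset (Fin n)).powerset, ∏ j ∈ T, e j * P j := by
        refine Finset.sum_le_sum fun T _ => ?_
        rw [Finset.prod_mul_distrib]
        exact mul_le_mul_of_nonneg_left (hneg T) (Finset.prod_nonneg fun j _ => he0 j)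
    _ = ∏ j, (1 + e j * P j) := (Finset.prod_one_add _).symm
    _ ≤ ∏ j, Real.exp (2 * (c j * P j)) := by
        refine Finset.prod_le_prod
          (fun j _ => add_nonneg zero_le_one (mul_nonneg (he0 j) (hP j))) fun j _ => ?_
        have h1 : 1 + e j * P j ≤ 2 * (c j * P j) + 1 := by
          nlinarith [mul_le_mul_of_nonneg_right (he2 j) (hP j)]
        exact h1.trans (Real.add_one_le_exp _)
    _ = Real.exp (2 * ∑ y ∈ Y, w y * (c ⬝ᵥ y)) := by
        rw [← Real.exp_sum, ← Finset.mul_sum, hlin]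

-- Exponential Markov inequality for c / M, whose entries are at most 1. The moment bound exp (2μ /
-- M) cancels the part 2μ of the threshold, and the part M l leaves exp (-l).
open scoped Classical in
lemma sum_tail_le_exp (hw : ∀ y, 0 ≤ w y)
    (h01 : ∀ y ∈ Y, ∀ j, y j = 0 ∨ y j = 1)
    (hneg : ∀ T : Finset (Fin n),
      ∑ y ∈ Y, w y * ∏ j ∈ T, y j ≤ ∏ j ∈ T, ∑ y ∈ Y, w y * y j)
    {c : Fin n → ℝ} (hc0 : 0 ≤ c) {M : ℝ} (hM : 0 < M) (hcM : ∀ j, c j ≤ M) {μ l : ℝ}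
    (hμ : ∑ y ∈ Y, w y * (c ⬝ᵥ y) ≤ μ) :
    ∑ y ∈ Y, (if 2 * μ + M * l < c ⬝ᵥ y then w y else 0) ≤ Real.exp (-l) := by
  have hc' : 0 ≤ M⁻¹ • c := smul_nonneg (inv_nonneg.2 hM.le) hc0
  have h1 := sum_exp_le hw h01 hneg hc' (fun j => by
    rw [Pi.smul_apply, smul_eq_mul, inv_mul_le_iff₀ hM]; simpa using hcM j)
  have h2 : ∑ y ∈ Y, w y * (M⁻¹ • c ⬝ᵥ y) ≤ M⁻¹ * μ := by
    simp_rw [smul_dotProduct, smul_eq_mul, mul_left_comm (w _) M⁻¹, ← Finset.mul_sum]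
    exact mul_le_mul_of_nonneg_left hμ (inv_nonneg.2 hM.le)
  calc ∑ y ∈ Y, (if 2 * μ + M * l < c ⬝ᵥ y then w y else 0)
      ≤ ∑ y ∈ Y, w y * Real.exp (M⁻¹ • c ⬝ᵥ y) * Real.exp (-(2 * (M⁻¹ * μ) + l)) := by
        refine Finset.sum_le_sum fun y _ => ?_
        split_ifs with h
        · rw [mul_assoc, ← Real.exp_add]
          refine le_mul_of_one_le_right (hw y) (Real.one_le_exp ?_)
          have h3 : 2 * (M⁻¹ * μ) + l ≤ M⁻¹ * (c ⬝ᵥ y) := by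
            have := mul_le_mul_of_nonneg_left h.le (inv_nonneg.2 hM.le)
            have h4 : M⁻¹ * (2 * μ + M * l) = 2 * (M⁻¹ * μ) + l := by field_simp
            linarith
          rw [smul_dotProduct, smul_eq_mul]
          linarith
        · exact mul_nonneg (mul_nonneg (hw y) (Real.exp_nonneg _)) (Real.exp_nonneg _)
    _ ≤ Real.exp (2 * (M⁻¹ * μ)) * Real.exp (-(2 * (M⁻¹ * μ) + l)) := by
        rw [← Finset.sum_mul]
        refine mul_le_mul_of_nonneg_right (h1.trans (Real.exp_le_exp.2 ?_)) (Real.exp_nonneg _)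
        linarith
    _ = Real.exp (-l) := by
        rw [← Real.exp_add]
        congr 1
        ring

open scoped Classical in
/-- Markov's inequality. -/
lemma sum_tail_le_quarter (hw : ∀ y, 0 ≤ w y) {Z : (Fin n → ℝ) → ℝ} (hZ : ∀ y ∈ Y, 0 ≤ Z y)
    {B : ℝ} (hB : ∑ y ∈ Y, w y * Z y ≤ B) :
    ∑ y ∈ Y, (if 4 * B < Z y then w y else 0) ≤ 1 / 4 := by
  have hnn : ∀ y ∈ Y, 0 ≤ w y * Z y := fun y hy => mul_nonneg (hw y) (hZ y hy)
  have hB0 : 0 ≤ B := (Finset.sum_nonneg hnn).trans hB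
  -- For B = 0 one cannot divide by B, but then every product w y * Z y vanishes and the event
  -- carries no weight.
  rcases hB0.eq_or_lt with h0 | hpos
  · have hz := (Finset.sum_eq_zero_iff_of_nonneg hnn).1
      (le_antisymm (h0 ▸ hB) (Finset.sum_nonneg hnn))
    rw [Finset.sum_eq_zero]
    · norm_num
    · intro y hy
      split_ifs with h
      · rcases mul_eq_zero.1 (hz y hy) with h1 | h1
        · exact h1
        · linarith
      · rfl
  · calc ∑ y ∈ Y, (if 4 * B < Z y then w y else 0) ≤ ∑ y ∈ Y, w y * Z y * (4 * B)⁻¹ := by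
          refine Finset.sum_le_sum fun y hy => ?_
          split_ifs with h
          · rw [← div_eq_mul_inv, le_div_iff₀ (by positivity)]
            exact mul_le_mul_of_nonneg_left h.le (hw y)
          · exact mul_nonneg (hnn y hy) (by positivity)
      _ ≤ B * (4 * B)⁻¹ := by
          rw [← Finset.sum_mul]
          exact mul_le_mul_of_nonneg_right hB (by positivity)
      _ = 1 / 4 := by field_simp

end Weights

/-! ### One call of the verifier -/

section Rounding

variable {n : ℕ} {S : Set (Fin n → ℝ)} {p : PMF (Fin n → ℝ)}

lemma toOuterMeasure_eq_sum (hfin : S.Finite) (hp : p.support ⊆ S) (B : Set (Fin n → ℝ))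
    [DecidablePred (· ∈ B)] :
    p.toOuterMeasure B =
      ENNReal.ofReal (∑ y ∈ hfin.toFinset, if y ∈ B then (p y).toReal else 0) := by
  rw [PMF.toOuterMeasure_apply, tsum_eq_sum (s := hfin.toFinset),
    ENNReal.ofReal_sum_of_nonneg]
  · refine Finset.sum_congr rfl fun y _ => ?_
    by_cases h : y ∈ B <;> simp [h, ENNReal.ofReal_toReal (p.apply_ne_top y)]
  · intro y _
    split_ifs <;> simp
  · intro y hy
    have : p y = 0 := (p.apply_eq_zero_iff y).2 fun h => hy (by simpa using hp h)
    by_cases h : y ∈ B <;> simp [h, this]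

lemma expectedCost_eq_sum (hfin : S.Finite) (hp : p.support ⊆ S) (c : Fin n → ℝ) :
    expectedCost p c = ∑ y ∈ hfin.toFinset, (p y).toReal * (c ⬝ᵥ y) := by
  refine tsum_eq_sum fun y hy => ?_
  have : p y = 0 := (p.apply_eq_zero_iff y).2 fun h => hy (by simpa using hp h)
  simp [this]

/-- On 0/1 vectors the indicator of "y j = 1 for all j ∈ T" is the product of the y j, so negative
correlation of events becomes an inequality between real moments. -/
lemma IsANCRR.sum_prod_le {α : ℝ} {x : Fin n → ℝ} (h : IsANCRR α S x p) (hfin : S.Finite)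
    (h01 : ∀ x ∈ S, ∀ j, x j = 0 ∨ x j = 1) (T : Finset (Fin n)) :
    ∑ y ∈ hfin.toFinset, (p y).toReal * ∏ j ∈ T, y j ≤
      ∏ j ∈ T, ∑ y ∈ hfin.toFinset, (p y).toReal * y j := by
  classical
  have hprod : ∀ T : Finset (Fin n), ∀ y ∈ hfin.toFinset,
      (if ∀ j ∈ T, y j = 1 then (p y).toReal else 0) = (p y).toReal * ∏ j ∈ T, y j := by
    intro T y hy
    split_ifs with h1
    · rw [Finset.prod_eq_one h1, mul_one]
    · push Not at h1
      obtain ⟨j, hj, hne⟩ := h1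
      rw [Finset.prod_eq_zero hj ((h01 y (by simpa using hy) j).resolve_right hne), mul_zero]
  have hnn : ∀ T : Finset (Fin n), 0 ≤ ∑ y ∈ hfin.toFinset, (p y).toReal * ∏ j ∈ T, y j := by
    intro T
    rw [← Finset.sum_congr rfl (hprod T)]
    exact Finset.sum_nonneg fun y _ => by split_ifs <;> simp
  have hev : ∀ T : Finset (Fin n), p.toOuterMeasure {y | ∀ j ∈ T, y j = 1} =
      ENNReal.ofReal (∑ y ∈ hfin.toFinset, (p y).toReal * ∏ j ∈ T, y j) := by
    intro T
    rw [toOuterMeasure_eq_sum hfin h.mem, ← Finset.sum_congr rfl (hprod T)]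
    simp only [Set.mem_ofPred_eq]
  have hone : ∀ j, p.toOuterMeasure {y | y j = 1} =
      ENNReal.ofReal (∑ y ∈ hfin.toFinset, (p y).toReal * y j) := by
    intro j
    have := hev {j}
    simpa using this
  have hnn1 : ∀ j, 0 ≤ ∑ y ∈ hfin.toFinset, (p y).toReal * y j := by
    intro j
    simpa using hnn {j}
  have := h.negCorrelated T
  simp_rw [hone] at this
  rw [hev, ← ENNReal.ofReal_prod_of_nonneg fun j _ => hnn1 j] at this
  exact (ENNReal.ofReal_le_ofReal_iff (Finset.prod_nonneg fun j _ => hnn1 j)).1 this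

variable {k m : ℕ} {A : Matrix (Fin m) (Fin k) ℝ} {b : Fin m → ℝ} {c0 : Fin n → ℝ}
  {C : Fin k → Fin n → ℝ}

/-- The deterministic part of the analysis of one rounding step: if the coordinates with large
fractional value satisfy the Chernoff bound and the aggregated rest satisfies the Markov bound,
then the worst-case cost of the rounded point is small. -/
lemma cost_le_of_good (hA : ∀ i r, 0 ≤ A i r) (hp : ∀ r, ∃ i, 0 < A i r) (hb : 0 ≤ b)
    (hC : 0 ≤ C) {x y : Fin n → ℝ} (hx : 0 ≤ x) (hy : 0 ≤ y) {a τ W : ℝ} (ha : 0 ≤ a)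
    (hlarge : ∀ r, τ ≤ genValues C x r → genValues C y r ≤ a * genValues C x r)
    (hsmall : (c0 + ∑ r, (if τ ≤ genValues C x r then 0 else
      worstCase A b (Pi.single r 1)) • C r) ⬝ᵥ y ≤ W) :
    c0 ⬝ᵥ y + worstCase A b (genValues C y) ≤ a * worstCase A b (genValues C x) + W := by
  rw [dotProduct_uncertainty] at hsmall
  rw [← le_sub_iff_add_le']
  refine worstCase_le hb fun δ hδ => ?_
  -- Coordinatewise: a large generator is charged to its value at x, a small one uses that δ r is at
  -- most the worst case of the unit vector.
  have h1 : δ ⬝ᵥ genValues C y ≤ a * (δ ⬝ᵥ genValues C x) +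
      (fun r => if τ ≤ genValues C x r then 0 else worstCase A b (Pi.single r 1)) ⬝ᵥ
        genValues C y := by
    simp only [dotProduct, Finset.mul_sum]
    rw [← Finset.sum_add_distrib]
    refine Finset.sum_le_sum fun r _ => ?_
    have hyr : 0 ≤ genValues C y r := dotProduct_nonneg_of_nonneg (hC r) hy
    have hxr : 0 ≤ genValues C x r := dotProduct_nonneg_of_nonneg (hC r) hx
    have hδr : 0 ≤ δ r := hδ.1 r
    split_ifs with h
    · have := mul_le_mul_of_nonneg_left (hlarge r h) hδr
      linarith
    · have h2 := mul_le_mul_of_nonneg_right (le_worstCase_single hA hp hδ r) hyr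
      have h3 : 0 ≤ a * (δ r * genValues C x r) := by positivity
      linarith
  have h2 := mul_le_mul_of_nonneg_left (le_worstCase hA hp hδ (genValues C x)) ha
  linarith

/-- A rounded optimal solution for the right guess of the dominating generator is good with
probability at least one half. -/
lemma toOuterMeasure_bad_le_half (hA : ∀ i r, 0 ≤ A i r) (hp : ∀ r, ∃ i, 0 < A i r)
    (hb : 0 ≤ b) (hc0 : 0 ≤ c0) (hC : 0 ≤ C) (hCpos : ∃ r j, 0 < C r j) (hfin : S.Finite)
    (h01 : ∀ x ∈ S, ∀ j, x j = 0 ∨ x j = 1) {α : ℝ} (hα : 1 ≤ α) {x : Fin n → ℝ}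
    (hx : 0 ≤ x) (hV : IsANCRR α S x p) {D opt ρ : ℝ} (hD : 0 ≤ D)
    (hDopt : cMin C * D ≤ opt)
    (hxopt : c0 ⬝ᵥ x + worstCase A b (genValues C x) ≤ opt)
    (hzero : ∀ r, D < worstCase A b (Pi.single r 1) → genValues C x r ≤ 0)
    (hρ0 : 0 ≤ ρ)
    (hρ : (k : ℝ) * Real.log (max (k : ℝ) 2) * (cMax C / cMin C) ≤ ρ ^ 2) :
    p.toOuterMeasure {y | ¬ c0 ⬝ᵥ y + worstCase A b (genValues C y) ≤ 18 * (α * ρ) * opt} ≤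
      1 / 2 := by
  classical
  have hmin := cMin_pos C hCpos
  have hmax : 0 < cMax C := by
    obtain ⟨r, j, h⟩ := hCpos
    exact h.trans_le (le_cMax C r j)
  have hminmax : cMin C ≤ cMax C := by
    obtain ⟨r, j, h⟩ := hCpos
    exact (cMin_le C h).trans (le_cMax C r j)
  have hk : (1 : ℝ) ≤ k := by
    obtain ⟨r, -⟩ := hCpos
    exact_mod_cast (Fin.pos r)
  set κ : ℝ := max (k : ℝ) 2 with hκ
  have hκ2 : 2 ≤ κ := le_max_right _ _
  have hκk : (k : ℝ) ≤ κ := le_max_left _ _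
  have hlog2 : (0.64 : ℝ) ≤ Real.log κ :=
    le_trans (by linarith [Real.log_two_gt_d9]) (Real.log_le_log two_pos hκ2)
  have hlog : 0 < Real.log κ := by linarith
  have hratio : 1 ≤ cMax C / cMin C := (one_le_div hmin).2 hminmax
  -- From ρ² ≥ log 2 > 0.64; it lets the constant 4 be absorbed into 5ρ at the end.
  have hρ1 : 0.8 ≤ ρ := by
    have h1 : (0.64 : ℝ) ≤ k * Real.log κ * (cMax C / cMin C) := by
      have h2 : Real.log κ ≤ k * Real.log κ := le_mul_of_one_le_left hlog.le hk
      have h3 : k * Real.log κ ≤ k * Real.log κ * (cMax C / cMin C) :=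
        le_mul_of_one_le_right (by positivity) hratio
      linarith
    nlinarith
  have hρpos : 0 < ρ := by linarith
  have hopt : 0 ≤ opt := (mul_nonneg hmin.le hD).trans hDopt
  have hkey : k * cMax C * Real.log κ * D ≤ ρ ^ 2 * opt := by
    calc k * cMax C * Real.log κ * D
        = k * Real.log κ * (cMax C / cMin C) * (cMin C * D) := by field_simp
      _ ≤ ρ ^ 2 * opt := mul_le_mul hρ hDopt (mul_nonneg hmin.le hD) (sq_nonneg _)
  -- Chosen so that τρ is exactly the additive Chernoff error 3 c_max log κ.
  set τ : ℝ := 3 * cMax C * Real.log κ / ρ with hτ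
  have hτpos : 0 < τ := by positivity
  have hF : 0 ≤ worstCase A b (genValues C x) := worstCase_nonneg hA hp hb _
  have hc0x : 0 ≤ c0 ⬝ᵥ x := dotProduct_nonneg_of_nonneg hc0 hx
  have hgx : ∀ r, 0 ≤ genValues C x r := fun r => dotProduct_nonneg_of_nonneg (hC r) hx
  let d : Fin k → ℝ := fun r => if τ ≤ genValues C x r then 0 else
      worstCase A b (Pi.single r 1)
  have hd : ∀ r, 0 ≤ d r := by
    intro r
    simp only [d]
    split_ifs
    · exact le_rfl
    · exact worstCase_nonneg hA hp hb _
  let cS : Fin n → ℝ := c0 + ∑ r, d r • C r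
  have hcS : 0 ≤ cS := add_nonneg hc0 (Finset.sum_nonneg fun r _ => smul_nonneg (hd r) (hC r))
  have hcSx : cS ⬝ᵥ x ≤ c0 ⬝ᵥ x + k * (D * τ) := by
    simp only [cS]
    rw [dotProduct_uncertainty]
    refine add_le_add le_rfl ?_
    calc d ⬝ᵥ genValues C x ≤ ∑ _r : Fin k, D * τ := by
          refine Finset.sum_le_sum fun r _ => ?_
          simp only [d]
          split_ifs with h
          · rw [zero_mul]; positivity
          · rcases le_or_gt (worstCase A b (Pi.single r 1)) D with h1 | h1
            · exact mul_le_mul h1 (not_le.1 h).le (hgx r) hD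
            · rw [le_antisymm (hzero r h1) (hgx r), mul_zero]; positivity
      _ = k * (D * τ) := by simp
  let Y := hfin.toFinset
  let w : (Fin n → ℝ) → ℝ := fun y => (p y).toReal
  have hw : ∀ y, 0 ≤ w y := fun y => ENNReal.toReal_nonneg
  have hY01 : ∀ y ∈ Y, ∀ j, y j = 0 ∨ y j = 1 := fun y hy => h01 y (by simpa [Y] using hy)
  have hY0 : ∀ y ∈ Y, 0 ≤ y := fun y hy j => by rcases hY01 y hy j with h | h <;> simp [h]
  have hmean : ∀ c : Fin n → ℝ, 0 ≤ c → ∑ y ∈ Y, w y * (c ⬝ᵥ y) ≤ α * (c ⬝ᵥ x) :=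
    fun c hc => expectedCost_eq_sum hfin hV.mem c ▸ hV.expectation c hc
  have hneg := hV.sum_prod_le hfin h01
  have hmarkov := sum_tail_le_quarter (Y := Y) hw (Z := fun y => cS ⬝ᵥ y)
    (fun y hy => dotProduct_nonneg_of_nonneg hcS (hY0 y hy)) (hmean cS hcS)
  -- With l = 3 log κ each generator fails with weight at most κ⁻³, so all k together fail with
  -- weight at most κ⁻² ≤ 1/4. Markov's inequality adds another 1/4.
  have hchernoff : ∀ r, ∑ y ∈ Y, (if 2 * (α * (C r ⬝ᵥ x)) + cMax C * (3 * Real.log κ) <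
      C r ⬝ᵥ y then w y else 0) ≤ κ⁻¹ ^ 3 := by
    intro r
    refine (sum_tail_le_exp hw hY01 hneg (hC r) hmax (le_cMax C r)
      (hmean (C r) (hC r))).trans (le_of_eq ?_)
    rw [Real.exp_neg, mul_comm, Real.exp_mul, Real.exp_log (by linarith), inv_pow]
    norm_cast
  have hgood : ∀ y ∈ Y, cS ⬝ᵥ y ≤ 4 * (α * (cS ⬝ᵥ x)) →
      (∀ r, C r ⬝ᵥ y ≤ 2 * (α * (C r ⬝ᵥ x)) + cMax C * (3 * Real.log κ)) →
      c0 ⬝ᵥ y + worstCase A b (genValues C y) ≤ 18 * (α * ρ) * opt := by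
    intro y hy h1 h2
    have h3 := cost_le_of_good hA hp hb hC hx (hY0 y hy) (a := α * (2 + ρ)) (τ := τ)
      (by positivity) (fun r hr => ?_) h1
    · have h4 : 4 * (k * (D * τ)) ≤ 12 * ρ * opt := by
        have : 4 * (k * (D * τ)) = 12 * (k * cMax C * Real.log κ * D) / ρ := by
          rw [hτ]; ring
        rw [this, div_le_iff₀ hρpos]
        nlinarith
      -- The constant is 18 = 1 + 5 + 12: the LP solution costs at most (4 + ρ) opt with 4 ≤ 5ρ, and
      -- the small generators cost at most 12ρ opt.
      have h5 : (2 + ρ) * worstCase A b (genValues C x) + 4 * (cS ⬝ᵥ x) ≤ 18 * ρ * opt := by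
        have h6 : (2 + ρ) * worstCase A b (genValues C x) + 4 * (c0 ⬝ᵥ x) ≤ (4 + ρ) * opt := by
          nlinarith
        have h7 : 4 * opt ≤ 5 * ρ * opt := mul_le_mul_of_nonneg_right (by linarith) hopt
        nlinarith
      have := mul_le_mul_of_nonneg_left h5 (by linarith : (0 : ℝ) ≤ α)
      nlinarith
    · have h4 : cMax C * (3 * Real.log κ) ≤ ρ * genValues C x r := by
        have h5 : τ * ρ = cMax C * (3 * Real.log κ) := by
          rw [hτ]; field_simp
        have := mul_le_mul_of_nonneg_right hr hρpos.le
        linarith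
      have h5 : ρ * genValues C x r ≤ α * (ρ * genValues C x r) :=
        le_mul_of_one_le_left (mul_nonneg hρ0 (hgx r)) hα
      have h6 := h2 r
      simp only [genValues] at h4 h5 ⊢
      nlinarith
  rw [toOuterMeasure_eq_sum hfin hV.mem]
  refine ENNReal.ofReal_le_of_le_toReal ?_
  have hhalf : ((1 : ENNReal) / 2).toReal = 1 / 2 := by simp
  rw [hhalf]
  calc ∑ y ∈ Y, (if y ∈ {y | ¬ c0 ⬝ᵥ y + worstCase A b (genValues C y) ≤ 18 * (α * ρ) * opt}
        then w y else 0)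
      ≤ ∑ y ∈ Y, ((if 4 * (α * (cS ⬝ᵥ x)) < cS ⬝ᵥ y then w y else 0) +
          ∑ r, (if 2 * (α * (C r ⬝ᵥ x)) + cMax C * (3 * Real.log κ) <
            C r ⬝ᵥ y then w y else 0)) := by
        refine Finset.sum_le_sum fun y hy => ?_
        have hnn : ∀ r, 0 ≤ (if 2 * (α * (C r ⬝ᵥ x)) + cMax C * (3 * Real.log κ) <
            C r ⬝ᵥ y then w y else 0) := fun r => by
          split_ifs
          · exact hw y
          · exact le_rfl
        have hsum := Finset.sum_nonneg fun r (_ : r ∈ Finset.univ) => hnn r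
        by_cases hm : 4 * (α * (cS ⬝ᵥ x)) < cS ⬝ᵥ y
        · rw [if_pos hm]
          have : (if y ∈ {y | ¬ c0 ⬝ᵥ y + worstCase A b (genValues C y) ≤
              18 * (α * ρ) * opt} then w y else 0) ≤ w y := by
            split_ifs
            · exact le_rfl
            · exact hw y
          linarith
        · rw [if_neg hm, zero_add]
          by_cases hc : ∀ r, C r ⬝ᵥ y ≤ 2 * (α * (C r ⬝ᵥ x)) + cMax C * (3 * Real.log κ)
          · rw [if_neg (by simpa using hgood y hy (not_lt.1 hm) hc)]
            exact hsum
          · push Not at hc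
            obtain ⟨r, hr⟩ := hc
            have h1 := Finset.single_le_sum (fun r _ => hnn r) (Finset.mem_univ r)
            rw [if_pos hr] at h1
            refine le_trans ?_ h1
            split_ifs
            · exact le_rfl
            · exact hw y
    _ ≤ 1 / 4 + ∑ _r : Fin k, κ⁻¹ ^ 3 := by
        rw [Finset.sum_add_distrib, Finset.sum_comm]
        exact add_le_add hmarkov (Finset.sum_le_sum fun r _ => hchernoff r)
    _ ≤ 1 / 2 := by
        have h1 : (k : ℝ) * κ⁻¹ ^ 3 ≤ 1 / 4 := by
          have h2 : κ⁻¹ ≤ 1 / 2 := by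
            rw [inv_le_comm₀ (by linarith) (by norm_num)]; linarith
          have h3 : 0 < κ⁻¹ := inv_pos.2 (by linarith)
          calc (k : ℝ) * κ⁻¹ ^ 3 ≤ κ * κ⁻¹ ^ 3 :=
                mul_le_mul_of_nonneg_right hκk (by positivity)
            _ = κ⁻¹ ^ 2 := by field_simp
            _ ≤ (1 / 2) ^ 2 := pow_le_pow_left₀ h3.le h2 2
            _ = 1 / 4 := by norm_num
        simp only [Finset.sum_const, Finset.card_univ, Fintype.card_fin, nsmul_eq_mul]
        linarith

end Rounding

/-! ### Reasoning about programs -/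

section Bind

variable {σ τ : Type*}

/-- If the continuation avoids `B` outside a bad event and hits it with probability at most `ε`
on the bad event, then the composition hits `B` with probability at most `ε` times that of the bad
event. -/
lemma toOuterMeasure_bind_le (μ : PMF σ) (f : σ → PMF τ) {B : Set τ} {bad : Set σ} {ε : ENNReal}
    (h0 : ∀ s ∈ μ.support, s ∉ bad → ∀ t ∈ (f s).support, t ∉ B)
    (hε : ∀ s ∈ μ.support, s ∈ bad → (f s).toOuterMeasure B ≤ ε) :
    (μ.bind f).toOuterMeasure B ≤ μ.toOuterMeasure bad * ε := by
  rw [PMF.toOuterMeasure_bind_apply, PMF.toOuterMeasure_apply, ← ENNReal.tsum_mul_right]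
  refine ENNReal.tsum_le_tsum fun s => ?_
  by_cases hs : s ∈ μ.support
  · by_cases hb : s ∈ bad
    · rw [Set.indicator_of_mem hb]
      exact mul_le_mul_right (hε s hs hb) _
    · rw [(PMF.toOuterMeasure_apply_eq_zero_iff _ _).2
        (Set.disjoint_left.2 fun t ht => h0 s hs hb t ht), mul_zero]
      exact zero_le
  · rw [(PMF.apply_eq_zero_iff μ s).2 hs, zero_mul]
    exact zero_le

lemma toOuterMeasure_le_one (μ : PMF σ) (B : Set σ) : μ.toOuterMeasure B ≤ 1 := by
  rw [← (μ.toOuterMeasure_apply_eq_one_iff Set.univ).2 (Set.subset_univ _)]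
  exact μ.toOuterMeasure.mono (Set.subset_univ _)

variable (f : ℕ → σ → PMF σ)

lemma foldl_range_succ_bind (N : ℕ) (μ : PMF σ) :
    (List.range (N + 1)).foldl (fun (μ : PMF σ) (i : ℕ) => μ.bind (f i)) μ =
      ((List.range N).foldl (fun (μ : PMF σ) (i : ℕ) => μ.bind (f i)) μ).bind (f N) := by
  rw [List.range_succ, List.foldl_append]
  rfl

lemma foldl_support_invariant {f : ℕ → σ → PMF σ} {s₀ : σ} (I : ℕ → σ → Prop) (h0 : I 0 s₀) (N : ℕ)
    (hstep : ∀ i < N, ∀ s, I i s → ∀ s' ∈ (f i s).support, I (i + 1) s') :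
    ∀ s' ∈ ((List.range N).foldl (fun (μ : PMF σ) (i : ℕ) => μ.bind (f i))
      (PMF.pure s₀)).support, I N s' := by
  induction N with
  | zero =>
    intro s' hs'
    rw [List.range_zero, List.foldl_nil, PMF.mem_support_pure_iff] at hs'
    exact hs' ▸ h0
  | succ N ih =>
    intro s' hs'
    rw [foldl_range_succ_bind, PMF.mem_support_bind_iff] at hs'
    obtain ⟨s, hs, hs'⟩ := hs'
    exact hstep N N.lt_succ_self s (ih (fun i hi => hstep i (hi.trans N.lt_succ_self)) s hs) s' hs'

/-- Independent repetition: failure probabilities of the rounds multiply. -/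
lemma foldl_fail_le_prod {f : ℕ → σ → PMF σ} {s₀ : σ} (I G : σ → Prop) (ε : ℕ → ENNReal)
    (h0 : I s₀) (N : ℕ) (hI : ∀ i < N, ∀ s, I s → ∀ s' ∈ (f i s).support, I s')
    (hG : ∀ i < N, ∀ s, I s → G s → ∀ s' ∈ (f i s).support, G s')
    (hε : ∀ i < N, ∀ s, I s → (f i s).toOuterMeasure {s' | ¬ G s'} ≤ ε i) :
    ((List.range N).foldl (fun (μ : PMF σ) (i : ℕ) => μ.bind (f i))
      (PMF.pure s₀)).toOuterMeasure {s' | ¬ G s'} ≤ ∏ i ∈ Finset.range N, ε i := by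
  induction N with
  | zero =>
    rw [Finset.range_zero, Finset.prod_empty]
    exact toOuterMeasure_le_one _ _
  | succ N ih =>
    have hlt : ∀ i < N, i < N + 1 := fun i hi => hi.trans N.lt_succ_self
    have hsupp := foldl_support_invariant (f := f) (fun _ => I) h0 N
      (fun i hi => hI i (hlt i hi))
    rw [foldl_range_succ_bind, Finset.prod_range_succ]
    -- `G` is never lost, so failing after the last round means having failed before it and failing
    -- in it again.
    refine (toOuterMeasure_bind_le _ _ (bad := {s | ¬ G s}) (ε := ε N) ?_ ?_).trans ?_
    · intro s hs hb t ht hB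
      exact hB (hG N N.lt_succ_self s (hsupp s hs) (not_not.1 hb) t ht)
    · exact fun s hs _ => hε N N.lt_succ_self s (hsupp s hs)
    · exact mul_le_mul_left (ih (fun i hi => hI i (hlt i hi)) (fun i hi => hG i (hlt i hi))
        (fun i hi => hε i (hlt i hi))) _

end Bind

/-- Every possible final state of `P` started in `s` satisfies `φ`. -/
def Ensures {n : ℕ} (O : Oracles n) (P : Prog) (s : State) (φ : State → Prop) : Prop :=
  ∀ s' ∈ (P.run O s).support, φ s'

/-- `P` never assigns to register `v`. -/
def Prog.keepsReg (v : ℕ) : Prog → Bool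
  | skip => true
  | setReg w _ => w != v
  | write _ _ _ _ => true
  | seq P P' => P.keepsReg v && P'.keepsReg v
  | cond _ P P' => P.keepsReg v && P'.keepsReg v
  | loop w _ P => w != v && P.keepsReg v
  | solveLP _ _ _ _ _ _ _ _ _ flag => flag != v
  | callVerifier _ _ => true

/-- `P` never writes to array `a`. -/
def Prog.keepsArr (a : ℕ) : Prog → Bool
  | skip => true
  | setReg _ _ => true
  | write a' _ _ _ => a' != a
  | seq P P' => P.keepsArr a && P'.keepsArr a
  | cond _ P P' => P.keepsArr a && P'.keepsArr a
  | loop _ _ P => P.keepsArr a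
  | solveLP _ _ _ _ _ _ _ outX outY _ => outX != a && outY != a
  | callVerifier _ dst => dst != a

/-! ### Effect of elementary operations and Hoare-style rules for programs -/

namespace State

@[simp] lemma tick_reg (t : ℕ) (s : State) : (s.tick t).reg = s.reg := rfl
@[simp] lemma tick_arr (t : ℕ) (s : State) : (s.tick t).arr = s.arr := rfl
@[simp] lemma setReg_reg (v a : ℕ) (s : State) :
    (s.setReg v a).reg = Function.update s.reg v a := rfl
@[simp] lemma setReg_arr (v a : ℕ) (s : State) : (s.setReg v a).arr = s.arr := rfl
@[simp] lemma setEntry_reg (a i j : ℕ) (t : ℝ) (s : State) : (s.setEntry a i j t).reg = s.reg := rfl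
@[simp] lemma setVec_reg {d : ℕ} (a : ℕ) (x : Fin d → ℝ) (s : State) :
    (s.setVec a x).reg = s.reg := rfl

lemma setEntry_arr_self (a i j : ℕ) (t : ℝ) (s : State) : (s.setEntry a i j t).arr a =
    Function.update (s.arr a) i (Function.update (s.arr a i) j t) := by
  simp [setEntry]

lemma setEntry_arr_of_ne {a a' : ℕ} (h : a' ≠ a) (i j : ℕ) (t : ℝ) (s : State) :
    (s.setEntry a i j t).arr a' = s.arr a' := by
  simp [setEntry, h]

lemma setVec_arr_self {d : ℕ} (a : ℕ) (x : Fin d → ℝ) (s : State) (j : Fin d) :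
    (s.setVec a x).arr a 0 j = x j := by
  simp [setVec]

lemma setVec_arr_of_ne {d a a' : ℕ} (h : a' ≠ a) (x : Fin d → ℝ) (s : State) :
    (s.setVec a x).arr a' = s.arr a' := by
  simp [setVec, h]

end State

section Rules

variable {n : ℕ} {O : Oracles n} {P P' : Prog} {s : State} {φ ψ : State → Prop}

lemma ensures_skip (h : φ s) : Ensures O .skip s φ := by
  intro s' hs'
  rw [Prog.run, PMF.mem_support_pure_iff] at hs'
  exact hs' ▸ h

lemma ensures_write {a : ℕ} {i j : NExp} {e : RExp}
    (h : φ ((s.setEntry a (i.eval s) (j.eval s) (e.eval s)).tick 1)) :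
    Ensures O (.write a i j e) s φ := by
  intro s' hs'
  rw [Prog.run, PMF.mem_support_pure_iff] at hs'
  exact hs' ▸ h

lemma Ensures.seq (h : Ensures O P s ψ) (h' : ∀ s', ψ s' → Ensures O P' s' φ) :
    Ensures O (.seq P P') s φ := by
  intro s' hs'
  rw [Prog.run, PMF.mem_support_bind_iff] at hs'
  obtain ⟨t, ht, hs'⟩ := hs'
  exact h' t (h t ht) s' hs'

lemma ensures_cond {t : Test} (h : t.holds s → Ensures O P (s.tick 1) φ)
    (h' : ¬ t.holds s → Ensures O P' (s.tick 1) φ) : Ensures O (.cond t P P') s φ := by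
  intro s' hs'
  rw [Prog.run] at hs'
  split_ifs at hs' with ht
  · exact h ht s' hs'
  · exact h' ht s' hs'

lemma ensures_loop {v : ℕ} {e : NExp} (I : ℕ → State → Prop) (h0 : I 0 (s.tick 1))
    (hstep : ∀ i < e.eval s, ∀ s', I i s' → Ensures O P ((s'.setReg v i).tick 1) (I (i + 1))) :
    Ensures O (.loop v e P) s (I (e.eval s)) :=
  foldl_support_invariant I h0 _ hstep

lemma Ensures.imp (h : Ensures O P s φ) (h' : ∀ s', φ s' → ψ s') : Ensures O P s ψ :=
  fun s' hs' => h' s' (h s' hs')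

/-- The check is syntactic, so for a concrete program the frame conditions are settled by `decide`.
-/
lemma ensures_keepsReg {v : ℕ} (hP : P.keepsReg v = true) :
    ∀ s, Ensures O P s fun s' => s'.reg v = s.reg v := by
  induction P with
  | skip => exact fun s => ensures_skip rfl
  | setReg w e =>
    intro s s' hs'
    rw [Prog.run, PMF.mem_support_pure_iff] at hs'
    have : v ≠ w := (bne_iff_ne.1 hP).symm
    simp [hs', this]
  | write a i j e => exact fun s => ensures_write rfl
  | seq P P' ih ih' =>
    intro s
    simp only [Prog.keepsReg, Bool.and_eq_true] at hP
    exact (ih hP.1 s).seq fun s' hs' => (ih' hP.2 s').imp fun s'' h => h.trans hs'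
  | cond t P P' ih ih' =>
    intro s
    simp only [Prog.keepsReg, Bool.and_eq_true] at hP
    exact ensures_cond (fun _ => ih hP.1 _) fun _ => ih' hP.2 _
  | loop w e P ih =>
    intro s
    simp only [Prog.keepsReg, Bool.and_eq_true] at hP
    have : v ≠ w := (bne_iff_ne.1 hP.1).symm
    exact ensures_loop (fun _ s' => s'.reg v = s.reg v) rfl fun i _ s' hs' =>
      (ih hP.2 _).imp fun s'' h => by simpa [this, hs'] using h
  | solveLP rows aux MX MY rhs objX objY outX outY flag =>
    intro s s' hs'
    have : v ≠ flag := (bne_iff_ne.1 hP).symm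
    rw [Prog.run] at hs'
    dsimp only at hs'
    split at hs' <;> rw [PMF.mem_support_pure_iff] at hs' <;> simp [hs', this]
  | callVerifier src dst =>
    intro s s' hs'
    rw [Prog.run, PMF.mem_support_bind_iff] at hs'
    obtain ⟨y, -, hs'⟩ := hs'
    rw [PMF.mem_support_pure_iff] at hs'
    simp [hs']

lemma ensures_keepsArr {a : ℕ} (hP : P.keepsArr a = true) :
    ∀ s, Ensures O P s fun s' => s'.arr a = s.arr a := by
  induction P with
  | skip => exact fun s => ensures_skip rfl
  | setReg w e =>
    intro s s' hs'
    rw [Prog.run, PMF.mem_support_pure_iff] at hs'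
    simp [hs']
  | write a' i j e =>
    have : a ≠ a' := (bne_iff_ne.1 hP).symm
    exact fun s => ensures_write (by simp [State.setEntry_arr_of_ne this])
  | seq P P' ih ih' =>
    intro s
    simp only [Prog.keepsArr, Bool.and_eq_true] at hP
    exact (ih hP.1 s).seq fun s' hs' => (ih' hP.2 s').imp fun s'' h => h.trans hs'
  | cond t P P' ih ih' =>
    intro s
    simp only [Prog.keepsArr, Bool.and_eq_true] at hP
    exact ensures_cond (fun _ => ih hP.1 _) fun _ => ih' hP.2 _
  | loop w e P ih =>
    intro s
    simp only [Prog.keepsArr] at hP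
    exact ensures_loop (fun _ s' => s'.arr a = s.arr a) rfl fun i _ s' hs' =>
      (ih hP _).imp fun s'' h => by simpa [hs'] using h
  | solveLP rows aux MX MY rhs objX objY outX outY flag =>
    intro s s' hs'
    simp only [Prog.keepsArr, Bool.and_eq_true] at hP
    have h1 : a ≠ outX := (bne_iff_ne.1 hP.1).symm
    have h2 : a ≠ outY := (bne_iff_ne.1 hP.2).symm
    rw [Prog.run] at hs'
    dsimp only at hs'
    split at hs' <;> rw [PMF.mem_support_pure_iff] at hs' <;>
      simp [hs', State.setVec_arr_of_ne h1, State.setVec_arr_of_ne h2]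
  | callVerifier src dst =>
    intro s s' hs'
    have h1 : a ≠ dst := (bne_iff_ne.1 hP).symm
    rw [Prog.run, PMF.mem_support_bind_iff] at hs'
    obtain ⟨y, -, hs'⟩ := hs'
    rw [PMF.mem_support_pure_iff] at hs'
    simp [hs', State.setVec_arr_of_ne h1]

/-- Consequence rule with the frame conditions of the program at hand. -/
lemma Ensures.mono (h : Ensures O P s φ)
    (h' : ∀ s', (∀ v, P.keepsReg v = true → s'.reg v = s.reg v) →
      (∀ a, P.keepsArr a = true → s'.arr a = s.arr a) → φ s' → ψ s') : Ensures O P s ψ :=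
  fun s' hs' => h' s' (fun _ hv => ensures_keepsReg hv s s' hs')
    (fun _ ha => ensures_keepsArr ha s s' hs') (h s' hs')

/-- What a call of the solver does. -/
lemma ensures_solveLP {Q : Set (Fin n → ℝ)} (hO : IsLPSolver Q O.solve) {rows aux : NExp}
    {MX MY rhs objX objY outX outY flag : ℕ} (hout : outX ≠ outY) {l d : ℕ}
    (hl : rows.eval s = l) (hd : aux.eval s = d) {q : RelaxLP n}
    {MX' : Matrix (Fin l) (Fin n) ℝ} {MY' : Matrix (Fin l) (Fin d) ℝ} {rhs' : Fin l → ℝ}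
    {objX' : Fin n → ℝ} {objY' : Fin d → ℝ}
    (hMX : ∀ (i : Fin l) (j : Fin n), s.arr MX i j = MX' i j)
    (hMY : ∀ (i : Fin l) (j : Fin d), s.arr MY i j = MY' i j)
    (hrhs : ∀ i : Fin l, s.arr rhs 0 i = rhs' i) (hobjX : ∀ j : Fin n, s.arr objX 0 j = objX' j)
    (hobjY : ∀ j : Fin d, s.arr objY 0 j = objY' j) (hq : q = ⟨l, d, MX', MY', rhs', objX', objY'⟩) :
    Ensures O (.solveLP rows aux MX MY rhs objX objY outX outY flag) s fun s' =>
      (s'.reg flag = 1 ∧ ∃ z, q.IsOptimal Q z ∧ (∀ j : Fin n, s'.arr outX 0 j = z.1 j) ∧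
        ∀ j : Fin q.aux, s'.arr outY 0 j = z.2 j) ∨
      (s'.reg flag = 0 ∧ ∀ z, ¬ q.IsOptimal Q z) := by
  subst hl hd
  obtain rfl : s.mat MX _ _ = MX' := by ext i j; exact hMX i j
  obtain rfl : s.mat MY _ _ = MY' := by ext i j; exact hMY i j
  obtain rfl : s.vec rhs _ = rhs' := by ext i; exact hrhs i
  obtain rfl : s.vec objX _ = objX' := by ext i; exact hobjX i
  obtain rfl : s.vec objY _ = objY' := by ext i; exact hobjY i
  subst hq
  intro s' hs'
  rw [Prog.run] at hs'
  dsimp only at hs'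
  split at hs'
  · next z hz =>
    rw [PMF.mem_support_pure_iff] at hs'
    subst hs'
    refine .inl ⟨by simp, z, (hO _).1 z hz, fun j => ?_, fun j => ?_⟩
    · rw [State.setReg_arr, State.setVec_arr_of_ne hout, State.setVec_arr_self]
    · rw [State.setReg_arr, State.setVec_arr_self]
  · next hz =>
    rw [PMF.mem_support_pure_iff] at hs'
    subst hs'
    exact .inr ⟨by simp, (hO _).2 hz⟩

end Rules

/-! ### Two loop idioms -/

/-- Run `body` for all values of registers `3` and `4` below the given bounds. -/
def fill (R D : NExp) (body : Prog) : Prog := .loop 3 R (.loop 4 D body)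

/-- Add the values of `e` over the range of loop register `4` to an array entry. -/
def accumulate (N : NExp) (a : ℕ) (i j : NExp) (e : RExp) : Prog :=
  .loop 4 N (.write a i j (.add (.read a i j) e))

section Idioms

variable {n : ℕ} {O : Oracles n} {s : State}

/-- `D` is evaluated afresh for every row, hence `hM` asks for its value in all states that differ
from `s` only in the two loop registers, among registers. -/
lemma ensures_fill {a : ℕ} {R D : NExp} {body : Prog} (f : ℕ → ℕ → ℝ) {N M : ℕ}
    (hN : R.eval s = N)
    (hM : ∀ s' : State, (∀ v, v ≠ 3 → v ≠ 4 → s'.reg v = s.reg v) → D.eval s' = M)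
    (hbody : ∀ s' : State, (∀ v, v ≠ 3 → v ≠ 4 → s'.reg v = s.reg v) →
      (∀ a' ≠ a, s'.arr a' = s.arr a') → s'.reg 3 < N → s'.reg 4 < M →
      Ensures O body s' fun s'' => s''.reg = s'.reg ∧ (∀ a' ≠ a, s''.arr a' = s'.arr a') ∧
        s''.arr a = Function.update (s'.arr a) (s'.reg 3)
          (Function.update (s'.arr a (s'.reg 3)) (s'.reg 4) (f (s'.reg 3) (s'.reg 4)))) :
    Ensures O (fill R D body) s fun s' => ∀ i < N, ∀ j < M, s'.arr a i j = f i j := by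
  let J : State → Prop := fun s' =>
    (∀ v, v ≠ 3 → v ≠ 4 → s'.reg v = s.reg v) ∧ ∀ a' ≠ a, s'.arr a' = s.arr a'
  subst hN
  refine (ensures_loop (fun i s' => J s' ∧ ∀ i' < i, ∀ j < M, s'.arr a i' j = f i' j)
    ⟨⟨fun _ _ _ => rfl, fun _ _ => rfl⟩, by simp⟩ ?_).imp fun s' h => h.2
  rintro i hi s' ⟨⟨hr, ha⟩, hf⟩
  have hM' := hM ((s'.setReg 3 i).tick 1) (fun v h3 h4 => by simp [h3, hr v h3 h4])
  -- Separates the finished rows from the current one, which is the shape of the inner invariant.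
  rw [show (fun s'' => J s'' ∧ ∀ i' < i + 1, ∀ j < M, s''.arr a i' j = f i' j) = fun s'' =>
    J s'' ∧ (∀ i' < i, ∀ j < M, s''.arr a i' j = f i' j) ∧ ∀ j < M, s''.arr a i j = f i j by
      ext s''; simp only [Nat.lt_succ_iff_lt_or_eq, or_imp, forall_and, forall_eq]]
  refine (ensures_loop (s := (s'.setReg 3 i).tick 1) (fun j s'' => (J s'' ∧ s''.reg 3 = i) ∧
    (∀ i' < i, ∀ j < M, s''.arr a i' j = f i' j) ∧ ∀ j' < j, s''.arr a i j' = f i j')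
    ⟨⟨⟨fun v h3 h4 => by simp [h3, hr v h3 h4], ha⟩, by simp⟩, hf, by simp⟩ ?_).imp ?_
  · rintro j hj s'' ⟨⟨⟨hr', ha'⟩, h3⟩, hf', hg'⟩
    rw [hM'] at hj
    refine (hbody ((s''.setReg 4 j).tick 1) (fun v h3 h4 => by simp [h4, hr' v h3 h4]) ha' (by simpa [h3] using hi)
      (by simpa using hj)).imp ?_
    rintro t ⟨hreg, harr, hta⟩
    simp only [State.tick_reg, State.tick_arr, State.setReg_reg, State.setReg_arr, ne_eq,
      Nat.reduceEqDiff, not_false_eq_true, Function.update_of_ne,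
      Function.update_self, h3] at hreg harr hta
    refine ⟨⟨⟨fun v h3 h4 => ?_, fun a' h => (harr a' h).trans (ha' a' h)⟩, ?_⟩, ?_, ?_⟩
    · rw [hreg, Function.update_of_ne h4, hr' v h3 h4]
    · rw [hreg, Function.update_of_ne (by norm_num), h3]
    · intro i' hi' j' hj'
      rw [hta, Function.update_of_ne hi'.ne, hf' i' hi' j' hj']
    · intro j' hj'
      rw [hta, Function.update_self]
      rcases Nat.lt_succ_iff_lt_or_eq.1 hj' with h | rfl
      · rw [Function.update_of_ne h.ne, hg' j' h]
      · rw [Function.update_self]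
  · rintro s'' ⟨⟨hJ, -⟩, hf', hg'⟩
    rw [hM'] at hg'
    exact ⟨hJ, hf', hg'⟩

/-- The summand is evaluated while array `a` is already changing, so `he` grants agreement of the
other arrays only. -/
lemma ensures_accumulate {N : NExp} {a : ℕ} {i j : NExp} {e : RExp} (f : ℕ → ℝ) {M i' j' : ℕ}
    (hN : N.eval s = M)
    (hi : ∀ s' : State, (∀ v ≠ 4, s'.reg v = s.reg v) → i.eval s' = i')
    (hj : ∀ s' : State, (∀ v ≠ 4, s'.reg v = s.reg v) → j.eval s' = j')
    (he : ∀ s' : State, (∀ v ≠ 4, s'.reg v = s.reg v) → (∀ a' ≠ a, s'.arr a' = s.arr a') →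
      s'.reg 4 < M → e.eval s' = f (s'.reg 4)) :
    Ensures O (accumulate N a i j e) s fun s' => s'.arr a = Function.update (s.arr a) i'
      (Function.update (s.arr a i') j' (s.arr a i' j' + ∑ t ∈ Finset.range M, f t)) := by
  subst hN
  refine (ensures_loop (fun t s' => (∀ v ≠ 4, s'.reg v = s.reg v) ∧
    (∀ a' ≠ a, s'.arr a' = s.arr a') ∧ s'.arr a = Function.update (s.arr a) i'
      (Function.update (s.arr a i') j' (s.arr a i' j' + ∑ t ∈ Finset.range t, f t)))
    ⟨fun _ _ => rfl, fun _ _ => rfl, by simp⟩ ?_).imp fun s' h => h.2.2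
  rintro t ht s' ⟨hr, ha, hs⟩
  have hr' : ∀ v ≠ 4, ((s'.setReg 4 t).tick 1).reg v = s.reg v := fun v h => by
    simp [h, hr v h]
  refine ensures_write ⟨hr', fun a' h => ?_, ?_⟩
  · rw [State.tick_arr, State.setEntry_arr_of_ne h]
    exact ha a' h
  · rw [State.tick_arr, State.setEntry_arr_self, RExp.eval, RExp.eval, hi _ hr', hj _ hr',
      he _ hr' ha (by simpa using ht)]
    simp only [State.tick_arr, State.setReg_arr, State.tick_reg, State.setReg_reg,
      Function.update_self, hs, Function.update_idem, Finset.sum_range_succ, add_assoc]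

end Idioms

/-! ### Polynomial running time -/

/-- The expression depends only on the input sizes. -/
def NExp.inputOnly : NExp → Bool
  | const _ => true
  | reg v => decide (v < 3)
  | add e f => e.inputOnly && f.inputOnly

/-- A polynomial bound for an index expression in the input sizes. -/
noncomputable def NExp.poly : NExp → Polynomial ℕ
  | const a => Polynomial.C a
  | reg _ => Polynomial.X
  | add e f => e.poly + f.poly

/-- Loop bounds and linear program sizes depend only on the input sizes. -/
def Prog.bounded : Prog → Bool
  | skip => true
  | setReg _ _ => true
  | write _ _ _ _ => true
  | seq P P' => P.bounded && P'.bounded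
  | cond _ P P' => P.bounded && P'.bounded
  | loop _ e P => e.inputOnly && P.bounded
  | solveLP rows aux _ _ _ _ _ _ _ _ => rows.inputOnly && aux.inputOnly
  | callVerifier _ _ => true

/-- A polynomial bound for the number of steps. -/
noncomputable def Prog.costPoly : Prog → Polynomial ℕ
  | skip => 0
  | setReg _ _ => 1
  | write _ _ _ _ => 1
  | seq P P' => P.costPoly + P'.costPoly
  | cond _ P P' => 1 + P.costPoly + P'.costPoly
  | loop _ e P => 1 + e.poly * (1 + P.costPoly)
  | solveLP rows aux _ _ _ _ _ _ _ _ => (rows.poly + 1) * (Polynomial.X + aux.poly + 1)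
  | callVerifier _ _ => Polynomial.X + 1

lemma NExp.eval_le_poly {s : State} {L : ℕ} (hs : ∀ v < 3, s.reg v ≤ L) :
    ∀ e : NExp, e.inputOnly = true → e.eval s ≤ e.poly.eval L
  | const a, _ => by simp [NExp.eval, NExp.poly]
  | reg v, h => by simpa [NExp.eval, NExp.poly] using hs v (by simpa [inputOnly] using h)
  | add e f, h => by
    simp only [inputOnly, Bool.and_eq_true] at h
    simpa [NExp.eval, NExp.poly] using
      add_le_add (e.eval_le_poly hs h.1) (f.eval_le_poly hs h.2)

/-- Registers 0, 1, 2 are never overwritten and stay at most L, so loop bounds and program sizes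
built from them are bounded by fixed polynomials in L. Structural induction adds up the costs; the
same polynomial serves for verifier calls. -/
lemma ensures_cost {n : ℕ} {O : Oracles n} {L : ℕ} (hn : n ≤ L) {P : Prog}
    (hP : P.bounded = true) (h3 : ∀ v < 3, P.keepsReg v = true) :
    ∀ s : State, (∀ v < 3, s.reg v ≤ L) → Ensures O P s fun s' =>
      s'.steps ≤ s.steps + P.costPoly.eval L ∧ s'.calls ≤ s.calls + P.costPoly.eval L := by
  induction P with
  | skip => exact fun s _ => ensures_skip (by simp)
  | setReg w e =>
    intro s _ s' hs'
    rw [Prog.run, PMF.mem_support_pure_iff] at hs'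
    simp [hs', State.tick, State.setReg, Prog.costPoly]
  | write a i j e =>
    exact fun s _ => ensures_write (by simp [State.tick, State.setEntry, Prog.costPoly])
  | seq P P' ih ih' =>
    intro s hs
    simp only [Prog.bounded, Prog.keepsReg, Bool.and_eq_true] at hP h3
    refine ((ih hP.1 (fun v hv => (h3 v hv).1) s hs).mono fun s' hr _ h => (⟨h, fun v hv => ?_⟩ :
      _ ∧ ∀ v < 3, s'.reg v ≤ L)).seq fun s' hs' =>
      (ih' hP.2 (fun v hv => (h3 v hv).2) s' hs'.2).imp fun s'' h => ?_
    · exact (hr v (h3 v hv).1).trans_le (hs v hv)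
    · simp only [Prog.costPoly, Polynomial.eval_add]
      omega
  | cond t P P' ih ih' =>
    intro s hs
    simp only [Prog.bounded, Prog.keepsReg, Bool.and_eq_true] at hP h3
    refine ensures_cond (fun _ => (ih hP.1 (fun v hv => (h3 v hv).1) (s.tick 1) hs).imp ?_)
      fun _ => (ih' hP.2 (fun v hv => (h3 v hv).2) (s.tick 1) hs).imp ?_
    all_goals
      intro s' h
      simp only [Prog.costPoly, Polynomial.eval_add, Polynomial.eval_one, State.tick] at h ⊢
      omega
  | loop w e P ih =>
    intro s hs
    simp only [Prog.bounded, Prog.keepsReg, Bool.and_eq_true] at hP h3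
    have hw : ∀ v < 3, v ≠ w := fun v hv => (bne_iff_ne.1 (h3 v hv).1).symm
    have he := e.eval_le_poly hs hP.1
    refine (ensures_loop (fun i s' => (∀ v < 3, s'.reg v ≤ L) ∧
      s'.steps ≤ s.steps + 1 + i * (1 + P.costPoly.eval L) ∧
      s'.calls ≤ s.calls + i * (1 + P.costPoly.eval L)) ⟨hs, by simp [State.tick], by
        simp [State.tick]⟩ ?_).imp ?_
    · rintro i - s' ⟨hr, h1, h2⟩
      have hr' : ∀ v < 3, ((s'.setReg w i).tick 1).reg v ≤ L := fun v hv => by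
        simp [hw v hv, hr v hv]
      refine (ih hP.2 (fun v hv => (h3 v hv).2) _ hr').mono fun s'' hreg _ h =>
        ⟨fun v hv => (hreg v (h3 v hv).2).trans_le (hr' v hv), ?_⟩
      simp only [State.tick, State.setReg] at h
      rw [add_one_mul]
      omega
    · rintro s' ⟨-, h1, h2⟩
      have := Nat.mul_le_mul_right (1 + P.costPoly.eval L) he
      simp only [Prog.costPoly, Polynomial.eval_add, Polynomial.eval_one, Polynomial.eval_mul]
      omega
  | solveLP rows aux MX MY rhs objX objY outX outY flag =>
    intro s hs s' hs'
    simp only [Prog.bounded, Bool.and_eq_true] at hP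
    have h1 := rows.eval_le_poly hs hP.1
    have h2 := aux.eval_le_poly hs hP.2
    have h4 : (rows.eval s + 1) * (n + aux.eval s + 1) ≤
        (rows.poly.eval L + 1) * (L + aux.poly.eval L + 1) :=
      Nat.mul_le_mul (by omega) (by omega)
    rw [Prog.run] at hs'
    dsimp only at hs'
    split at hs' <;> rw [PMF.mem_support_pure_iff] at hs' <;>
      simpa [hs', State.tick, State.setVec, State.setReg, Prog.costPoly] using h4
  | callVerifier src dst =>
    intro s hs s' hs'
    rw [Prog.run, PMF.mem_support_bind_iff] at hs'
    obtain ⟨y, -, hs'⟩ := hs'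
    rw [PMF.mem_support_pure_iff] at hs'
    simpa [hs', State.tick, State.setVec, Prog.costPoly] using hn

/-! ### The algorithm

Arrays `5`, `6`, `8` hold `-A`, `-b`, `-C`; array `7` stays zero. Array `13` holds the worst cases
of the unit vectors, followed by a zero. Array `18` holds the best score so far, where a solution of
worst-case cost `v` has score `1 / (1 + v)`. -/

/-- Store the negative of array `src` in array `a`. -/
def negate (a src : ℕ) (R D : NExp) : Prog :=
  fill R D (.write a (.reg 3) (.reg 4) (.sub (.const 0) (.read src (.reg 3) (.reg 4))))

/-- Store the negated data. -/
def prepare : Prog :=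
  .seq (negate 5 2 (.reg 2) (.reg 1))
    (.seq (negate 6 3 (.const 1) (.reg 2)) (negate 8 1 (.reg 1) (.reg 0)))

/-- Maximize `δᵀ y` over the perturbation set, where array `10` holds `-y`. -/
def maximize : Prog := .solveLP (.reg 2) (.reg 1) 7 5 6 7 10 11 12 7

/-- Store the worst cases of the unit vectors in array `13`. -/
def unitWorstCases : Prog :=
  .loop 3 (.reg 1) (.seq (.write 10 (.const 0) (.reg 3) (.const (-1)))
    -- For the unit vector of index r the optimal value is coordinate r of the maximizer itself.
    (.seq maximize (.seq (.write 13 (.const 0) (.reg 3) (.read 12 (.const 0) (.reg 3)))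
      (.write 10 (.const 0) (.reg 3) (.const 0)))))

/-- Store `1 + v` in array `17`, where `v` is the worst-case cost of the vector in array `16`. -/
def evaluate : Prog :=
  .seq (.loop 3 (.reg 1) (.seq (.write 10 (.const 0) (.reg 3) (.const 0))
      (accumulate (.reg 0) 10 (.const 0) (.reg 3) (.sub (.const 0)
        (.mul (.read 1 (.reg 3) (.reg 4)) (.read 16 (.const 0) (.reg 4)))))))
    (.seq maximize (.seq (.write 17 (.const 0) (.const 0) (.const 1))
      (.seq (accumulate (.reg 0) 17 (.const 0) (.const 0)
          (.mul (.read 0 (.const 0) (.reg 4)) (.read 16 (.const 0) (.reg 4))))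
        (accumulate (.reg 1) 17 (.const 0) (.const 0) (.sub (.const 0)
          (.mul (.read 10 (.const 0) (.reg 4)) (.read 12 (.const 0) (.reg 4))))))))

/-- Keep the vector in array `16` if it is at least as good as the best one so far. -/
def record : Prog :=
  -- Costs are nonnegative, so every score is positive and the initial entry 0 stands for infinite
  -- cost.
  .cond (.realLe (.read 18 (.const 0) (.const 0))
      (.div (.const 1) (.read 17 (.const 0) (.const 0))))
    (.seq (.write 18 (.const 0) (.const 0) (.div (.const 1) (.read 17 (.const 0) (.const 0))))
      (fill (.const 1) (.reg 0) (.write 4 (.reg 3) (.reg 4) (.read 16 (.reg 3) (.reg 4)))))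
    .skip

/-- Round the vector in array `14` once. -/
def trial : Prog := .seq (.callVerifier 14 16) (.seq evaluate record)

/-- Round the vector in array `14` repeatedly. -/
def attempts : Prog := .loop 6 (.add (.reg 0) (.add (.reg 1) (.reg 2))) trial

/-- Solve the relaxation in which all generators whose unit worst case exceeds entry number
`reg 5` of array `13` have value zero. -/
def relax : Prog :=
  .seq (fill (.reg 1) (.reg 2)
      (.cond (.realLe (.read 13 (.const 0) (.reg 3)) (.read 13 (.const 0) (.reg 5)))
        (.write 9 (.reg 3) (.reg 4) (.read 2 (.reg 4) (.reg 3)))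
        (.write 9 (.reg 3) (.reg 4) (.const 0))))
    (.solveLP (.reg 1) (.reg 2) 8 9 7 0 3 14 15 7)

/-- Solve the relaxation, and round its solution if there is one. -/
def guess : Prog := .seq relax (.cond (.natLe (.const 1) (.reg 7)) attempts .skip)

/-- The algorithm of the main theorem. -/
def algorithm : Prog :=
  -- The additional guess, index k, reads the zero after the k unit worst cases.
  .seq prepare (.seq unitWorstCases (.loop 5 (.add (.reg 1) (.const 1)) guess))

/-! ### Correctness of the algorithm -/

/-- The hypotheses of the main theorem on the data. -/
structure Setting {n k m : ℕ} (c0 : Fin n → ℝ) (C : Fin k → Fin n → ℝ)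
    (A : Matrix (Fin m) (Fin k) ℝ) (b : Fin m → ℝ) (S Q : Set (Fin n → ℝ)) (O : Oracles n) :
    Prop where
  c0_nonneg : 0 ≤ c0
  C_nonneg : 0 ≤ C
  A_nonneg : ∀ i r, 0 ≤ A i r
  b_nonneg : 0 ≤ b
  A_pos : ∀ r, ∃ i, 0 < A i r
  nonempty : S.Nonempty
  zero_one : ∀ x ∈ S, ∀ j, x j = 0 ∨ x j = 1
  relaxation : IsLPRelaxation S Q
  solver : IsLPSolver Q O.solve
  support_round : ∀ x ∈ Q, (O.round x).support ⊆ S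

/-- The worst-case cost of `x`. -/
noncomputable def cost {n k m : ℕ} (c0 : Fin n → ℝ) (C : Fin k → Fin n → ℝ)
    (A : Matrix (Fin m) (Fin k) ℝ) (b : Fin m → ℝ) (x : Fin n → ℝ) : ℝ :=
  c0 ⬝ᵥ x + worstCase A b (genValues C x)

/-- The relaxation in which all generators with unit worst case above `D` have value zero. -/
noncomputable def guessLP {n k m : ℕ} (c0 : Fin n → ℝ) (C : Fin k → Fin n → ℝ)
    (A : Matrix (Fin m) (Fin k) ℝ) (b : Fin m → ℝ) (D : ℝ) : RelaxLP n where
  rows := k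
  aux := m
  MX := Matrix.of fun r j => -C r j
  MY := Matrix.of fun r i =>
    open scoped Classical in if worstCase A b (Pi.single r 1) ≤ D then A i r else 0
  rhs := 0
  objX := c0
  objY := b

/-- The entries of array `13`. -/
noncomputable def threshold {k m : ℕ} (A : Matrix (Fin m) (Fin k) ℝ) (b : Fin m → ℝ) (g : ℕ) : ℝ :=
  if h : g < k then worstCase A b (Pi.single ⟨g, h⟩ 1) else 0

/-- The input and the negated data are in place. -/
structure Loaded {n k m : ℕ} (c0 : Fin n → ℝ) (C : Fin k → Fin n → ℝ)
    (A : Matrix (Fin m) (Fin k) ℝ) (b : Fin m → ℝ) (s : State) : Prop where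
  reg0 : s.reg 0 = n
  reg1 : s.reg 1 = k
  reg2 : s.reg 2 = m
  arr0 : ∀ j : Fin n, s.arr 0 0 j = c0 j
  arr1 : ∀ (r : Fin k) (j : Fin n), s.arr 1 r j = C r j
  arr2 : ∀ (i : Fin m) (r : Fin k), s.arr 2 i r = A i r
  arr3 : ∀ i : Fin m, s.arr 3 0 i = b i
  arr5 : ∀ (i : Fin m) (r : Fin k), s.arr 5 i r = -A i r
  arr6 : ∀ i : Fin m, s.arr 6 0 i = -b i
  arr7 : s.arr 7 = fun _ _ => 0
  arr8 : ∀ (r : Fin k) (j : Fin n), s.arr 8 r j = -C r j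

/-- `P` preserves the input and the negated data. -/
def Prog.keepsData (P : Prog) : Bool :=
  [0, 1, 2].all (fun v => P.keepsReg v) && [0, 1, 2, 3, 5, 6, 7, 8].all (fun a => P.keepsArr a)

section Correctness

variable {n k m : ℕ} {c0 : Fin n → ℝ} {C : Fin k → Fin n → ℝ} {A : Matrix (Fin m) (Fin k) ℝ}
  {b : Fin m → ℝ} {S Q : Set (Fin n → ℝ)} {O : Oracles n} {s : State}

lemma Loaded.of_agree {s' : State} (h : Loaded c0 C A b s)
    (hr : ∀ v ∈ [0, 1, 2], s'.reg v = s.reg v)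
    (ha : ∀ a ∈ [0, 1, 2, 3, 5, 6, 7, 8], s'.arr a = s.arr a) : Loaded c0 C A b s' := by
  simp only [List.mem_cons, List.not_mem_nil, or_false, forall_eq_or_imp, forall_eq] at hr ha
  obtain ⟨h0, h1, h2⟩ := hr
  obtain ⟨a0, a1, a2, a3, a5, a6, a7, a8⟩ := ha
  constructor
  · rw [h0, h.reg0]
  · rw [h1, h.reg1]
  · rw [h2, h.reg2]
  · rw [a0]; exact h.arr0
  · rw [a1]; exact h.arr1
  · rw [a2]; exact h.arr2
  · rw [a3]; exact h.arr3
  · rw [a5]; exact h.arr5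
  · rw [a6]; exact h.arr6
  · rw [a7]; exact h.arr7
  · rw [a8]; exact h.arr8

lemma Ensures.loaded {P : Prog} {φ : State → Prop} (h : Ensures O P s φ)
    (hs : Loaded c0 C A b s) (hP : P.keepsData = true) :
    Ensures O P s fun s' => Loaded c0 C A b s' ∧ φ s' := by
  simp only [Prog.keepsData, Bool.and_eq_true, List.all_eq_true] at hP
  exact h.mono fun s' hr ha hφ =>
    ⟨hs.of_agree (fun v hv => hr v (hP.1 v hv)) fun a h => ha a (hP.2 a h), hφ⟩

lemma ensures_write_seq {P : Prog} {φ : State → Prop} {a : ℕ} {i j : NExp} {e : RExp}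
    (h : Ensures O P ((s.setEntry a (i.eval s) (j.eval s) (e.eval s)).tick 1) φ) :
    Ensures O (.seq (.write a i j e) P) s φ :=
  (ensures_write (φ := fun s' => s' = _) rfl).seq fun _ hs' => hs' ▸ h

/-! ### Preprocessing and exact evaluation of the worst-case cost -/

lemma ensures_negate {a src : ℕ} (hne : src ≠ a) {R D : NExp} {N M : ℕ} (hN : R.eval s = N)
    (hM : ∀ s' : State, (∀ v, v ≠ 3 → v ≠ 4 → s'.reg v = s.reg v) → D.eval s' = M) :
    Ensures O (negate a src R D) s fun s' => ∀ i < N, ∀ j < M, s'.arr a i j = -s.arr src i j := by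
  refine ensures_fill (fun i j => -s.arr src i j) hN hM fun s' _ ha _ _ => ensures_write ?_
  refine ⟨rfl, fun a' h => State.setEntry_arr_of_ne h _ _ _ _, ?_⟩
  rw [State.tick_arr, State.setEntry_arr_self]
  simp [RExp.eval, NExp.eval, ha src hne]

lemma ensures_prepare : Ensures O prepare s fun s' =>
    (∀ i < s.reg 2, ∀ j < s.reg 1, s'.arr 5 i j = -s.arr 2 i j) ∧
    (∀ i < 1, ∀ j < s.reg 2, s'.arr 6 i j = -s.arr 3 i j) ∧
    ∀ i < s.reg 1, ∀ j < s.reg 0, s'.arr 8 i j = -s.arr 1 i j := by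
  have h5 : Ensures O (negate 5 2 (.reg 2) (.reg 1)) s _ := ensures_negate (M := s.reg 1)
    (by decide) rfl fun s' h => h 1 (by decide) (by decide)
  refine (h5.mono (ψ := fun s' => (∀ i < s.reg 2, ∀ j < s.reg 1, s'.arr 5 i j = -s.arr 2 i j) ∧
    s'.reg 0 = s.reg 0 ∧ s'.reg 1 = s.reg 1 ∧ s'.reg 2 = s.reg 2 ∧ s'.arr 3 = s.arr 3 ∧
    s'.arr 1 = s.arr 1) fun s' hr ha h => ⟨h, hr 0 (by decide), hr 1 (by decide),
      hr 2 (by decide), ha 3 (by decide), ha 1 (by decide)⟩).seq ?_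
  rintro s₁ ⟨h5, r0, r1, r2, a3, a1⟩
  have h6 : Ensures O (negate 6 3 (.const 1) (.reg 2)) s₁ _ := ensures_negate (N := 1)
    (M := s.reg 2) (by decide) rfl fun s' h => (h 2 (by decide) (by decide)).trans r2
  refine (h6.mono (ψ := fun s' => (∀ i < s.reg 2, ∀ j < s.reg 1, s'.arr 5 i j = -s.arr 2 i j) ∧
    (∀ i < 1, ∀ j < s.reg 2, s'.arr 6 i j = -s.arr 3 i j) ∧ s'.reg 0 = s.reg 0 ∧
    s'.reg 1 = s.reg 1 ∧ s'.arr 1 = s.arr 1) fun s' hr ha h => ⟨?_, a3 ▸ h,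
      (hr 0 (by decide)).trans r0, (hr 1 (by decide)).trans r1,
      (ha 1 (by decide)).trans a1⟩).seq ?_
  · rw [ha 5 (by decide)]
    exact h5
  rintro s₂ ⟨h5, h6, r0, r1, a1⟩
  have h8 : Ensures O (negate 8 1 (.reg 1) (.reg 0)) s₂ _ := ensures_negate (N := s.reg 1)
    (M := s.reg 0) (by decide) r1 fun s' h => (h 0 (by decide) (by decide)).trans r0
  refine h8.mono fun s' hr ha h => ⟨?_, ?_, a1 ▸ h⟩
  · rw [ha 5 (by decide)]
    exact h5
  · rw [ha 6 (by decide)]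
    exact h6

lemma ensures_prepare_initState : Ensures O prepare (initState c0 C A b) fun s =>
    Loaded c0 C A b s ∧ s.arr 10 = (fun _ _ => 0) ∧ s.arr 13 = (fun _ _ => 0) ∧
      s.arr 18 = fun _ _ => 0 := by
  refine ensures_prepare.mono fun s hr ha h => ?_
  obtain ⟨h5, h6, h8⟩ := h
  refine ⟨⟨hr 0 (by decide), hr 1 (by decide), hr 2 (by decide), ?_, ?_, ?_, ?_, ?_, ?_,
    ha 7 (by decide), ?_⟩, ha 10 (by decide), ha 13 (by decide), ha 18 (by decide)⟩
  · rw [ha 0 (by decide)]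
    simp [initState]
  · rw [ha 1 (by decide)]
    simp [initState]
  · rw [ha 2 (by decide)]
    simp [initState]
  · rw [ha 3 (by decide)]
    simp [initState]
  · intro i r
    rw [h5 i i.2 r r.2]
    simp [initState]
  · intro i
    rw [h6 0 one_pos i i.2]
    simp [initState]
  · intro r j
    rw [h8 r r.2 j j.2]
    simp [initState]

/-- Only programs over Q can be solved, so δ takes the role of the additional variables and x ∈ Q is
idle. The program is feasible because Q contains S, and its values are bounded below by minus the
worst case, so the solver cannot report `none`. -/
lemma ensures_maximize (hS : Setting c0 C A b S Q O) (h : Loaded c0 C A b s) {y : Fin k → ℝ}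
    (hy : ∀ r : Fin k, s.arr 10 0 r = -y r) : Ensures O maximize s fun s' =>
      ∃ δ ∈ perturbations A b, δ ⬝ᵥ y = worstCase A b y ∧ ∀ r : Fin k, s'.arr 12 0 r = δ r := by
  let q : RelaxLP n := ⟨m, k, 0, -A, -b, 0, -y⟩
  have hfeas : ∀ z : (Fin n → ℝ) × (Fin k → ℝ), z ∈ q.feasible Q ↔
      z.1 ∈ Q ∧ z.2 ∈ perturbations A b := by
    intro z
    simp [q, RelaxLP.feasible, perturbations, Matrix.neg_mulVec]
  have hval : ∀ z : (Fin n → ℝ) × (Fin k → ℝ), q.value z = -(z.2 ⬝ᵥ y) := by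
    intro z
    simp [q, RelaxLP.value, dotProduct_comm]
  obtain ⟨x, hx⟩ := hS.nonempty
  have hxQ := hS.relaxation.subset hx
  refine (ensures_solveLP hS.solver (rows := .reg 2) (aux := .reg 1)
    (q := q) (by decide) h.reg2 h.reg1 (fun i j => ?_)
    (fun i j => h.arr5 i j) (fun i => h.arr6 i) (fun j => ?_) hy rfl).imp ?_
  · simp [h.arr7]
  · simp [h.arr7]
  rintro s' (⟨-, z, ⟨hz, hmin⟩, -, hY⟩ | ⟨-, hno⟩)
  · have hz2 := ((hfeas z).1 hz).2
    refine ⟨z.2, hz2, le_antisymm (le_worstCase hS.A_nonneg hS.A_pos hz2 y)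
      (worstCase_le hS.b_nonneg fun δ hδ => ?_), hY⟩
    have := hmin (x, δ) ((hfeas (x, δ)).2 ⟨hxQ, hδ⟩)
    rw [hval z, hval (x, δ)] at this
    exact neg_le_neg_iff.1 this
  · exfalso
    obtain ⟨z, hz⟩ := RelaxLP.exists_isOptimal hS.relaxation.isHPoly q (B := -worstCase A b y)
      ⟨(x, 0), (hfeas (x, 0)).2 ⟨hxQ, zero_mem_perturbations hS.b_nonneg⟩⟩ fun z hz => by
        rw [hval z]
        exact neg_le_neg (le_worstCase hS.A_nonneg hS.A_pos ((hfeas z).1 hz).2 y)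
    exact hno z hz

/-- The preprocessing is complete. -/
structure Ready (c0 : Fin n → ℝ) (C : Fin k → Fin n → ℝ) (A : Matrix (Fin m) (Fin k) ℝ)
    (b : Fin m → ℝ) (s : State) : Prop extends Loaded c0 C A b s where
  arr13 : ∀ g ≤ k, s.arr 13 0 g = threshold A b g

lemma Ensures.ready {P : Prog} {φ : State → Prop} (h : Ensures O P s φ)
    (hs : Ready c0 C A b s) (hP : P.keepsData = true) (hP' : P.keepsArr 13 = true) :
    Ensures O P s fun s' => Ready c0 C A b s' ∧ φ s' :=
  (h.loaded hs.toLoaded hP).mono fun s' _ ha h =>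
    ⟨⟨h.1, by rw [ha 13 hP']; exact hs.arr13⟩, h.2⟩

lemma ensures_unitWorstCases (hS : Setting c0 C A b S Q O) (h : Loaded c0 C A b s)
    (h10 : s.arr 10 = fun _ _ => 0) (h13 : s.arr 13 = fun _ _ => 0) :
    Ensures O unitWorstCases s (Ready c0 C A b) := by
  have hk : (NExp.reg 1).eval s = k := h.reg1
  -- Row 0 of array 10 is zero again between iterations, and entry k of array 13 is never touched.
  refine (ensures_loop (fun i s' => Loaded c0 C A b s' ∧ (∀ j, s'.arr 10 0 j = 0) ∧
    (∀ g < i, s'.arr 13 0 g = threshold A b g) ∧ s'.arr 13 0 k = 0)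
    ⟨h.of_agree (fun _ _ => rfl) fun _ _ => rfl, by simp [h10], by simp, by simp [h13]⟩ ?_).imp ?_
  · rintro i hi s₁ ⟨hl, hz, hd, hdk⟩
    rw [hk] at hi
    set s₂ := (s₁.setReg 3 i).tick 1 with hs₂
    have hl₂ : Loaded c0 C A b s₂ := hl.of_agree (by simp [hs₂]) (by simp [hs₂])
    have h3 : s₂.reg 3 = i := by simp [hs₂]
    refine ensures_write_seq ?_
    set s₃ := (s₂.setEntry 10 ((NExp.const 0).eval s₂) ((NExp.reg 3).eval s₂)
      ((RExp.const (-1)).eval s₂)).tick 1 with hs₃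
    have h10₃ : s₃.arr 10 0 = Function.update (fun _ => 0) i (-1) := by
      rw [hs₃, State.tick_arr, State.setEntry_arr_self]
      simp only [NExp.eval, RExp.eval, h3, Function.update_self]
      rw [show s₂.arr 10 0 = fun _ => 0 from funext hz]
      simp
    have hkeep₃ : ∀ a ≠ 10, s₃.arr a = s₁.arr a := fun a ha => by
      rw [hs₃, State.tick_arr, State.setEntry_arr_of_ne ha]; rfl
    have hl₃ : Loaded c0 C A b s₃ := hl₂.of_agree (by simp [hs₃]) fun a ha => by
      rw [hkeep₃ a (by rintro rfl; simp at ha)]; rfl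
    have hmax := (ensures_maximize hS hl₃ (y := Pi.single ⟨i, hi⟩ 1) fun r => by
      rw [h10₃, Function.update_apply, Pi.single_apply]
      by_cases hr : (r : ℕ) = i <;> simp [Fin.ext_iff, hr]).loaded hl₃ (by decide)
    refine (hmax.mono (ψ := fun s₄ => Loaded c0 C A b s₄ ∧ s₄.reg 3 = i ∧
      s₄.arr 10 0 = Function.update (fun _ => 0) i (-1) ∧ s₄.arr 13 = s₁.arr 13 ∧
      s₄.arr 12 0 i = threshold A b i) ?_).seq ?_
    · rintro s₄ hr ha ⟨hl₄, δ, hδ, heq, h12⟩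
      refine ⟨hl₄, (hr 3 (by decide)).trans (by simp [hs₃, h3]), ?_, ?_, ?_⟩
      · rw [ha 10 (by decide), h10₃]
      · rw [ha 13 (by decide), hkeep₃ 13 (by decide)]
      · rw [threshold, dif_pos hi, ← heq, dotProduct_single, mul_one]
        exact h12 ⟨i, hi⟩
    · rintro s₄ ⟨hl₄, h3₄, h10₄, h13₄, h12₄⟩
      refine ensures_write_seq (ensures_write ⟨?_, ?_, ?_, ?_⟩)
      · refine hl₄.of_agree (by simp) fun a ha => ?_
        rw [State.tick_arr, State.setEntry_arr_of_ne (by rintro rfl; simp at ha), State.tick_arr,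
          State.setEntry_arr_of_ne (by rintro rfl; simp at ha)]
      · intro j
        rw [State.tick_arr, State.setEntry_arr_self]
        simp only [NExp.eval, RExp.eval, State.tick_reg, State.setEntry_reg, State.tick_arr, h3₄,
          Function.update_self]
        rw [State.setEntry_arr_of_ne (by decide), h10₄, Function.update_idem, Function.update_apply]
        simp
      all_goals
        rw [State.tick_arr, State.setEntry_arr_of_ne (by decide), State.tick_arr,
          State.setEntry_arr_self]
        simp only [NExp.eval, RExp.eval, h3₄, Function.update_self, h13₄, h12₄]
      · intro g hg
        rcases Nat.lt_succ_iff_lt_or_eq.1 hg with h | rfl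
        · rw [Function.update_of_ne h.ne, hd g h]
        · rw [Function.update_self]
      · rw [Function.update_of_ne hi.ne', hdk]
  · rintro s' ⟨hl, -, hd, hdk⟩
    rw [hk] at hd
    refine ⟨hl, fun g hg => ?_⟩
    rcases hg.lt_or_eq with h | rfl
    · exact hd g h
    · rw [hdk, threshold, dif_neg (lt_irrefl _)]

/-- The solver returns a point and not a value, so the worst case is recomputed as the inner product
of the stored maximizer with the generator values, whose negatives are in array 10. -/
lemma ensures_evaluate (hS : Setting c0 C A b S Q O) (h : Loaded c0 C A b s) {y : Fin n → ℝ}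
    (hy : ∀ j : Fin n, s.arr 16 0 j = y j) :
    Ensures O evaluate s fun s' => s'.arr 17 0 0 = 1 + cost c0 C A b y := by
  have hk : (NExp.reg 1).eval s = k := h.reg1
  have h1 : Ensures O (.loop 3 (.reg 1) (.seq (.write 10 (.const 0) (.reg 3) (.const 0))
      (accumulate (.reg 0) 10 (.const 0) (.reg 3) (.sub (.const 0)
        (.mul (.read 1 (.reg 3) (.reg 4)) (.read 16 (.const 0) (.reg 4))))))) s fun s' =>
      Loaded c0 C A b s' ∧ s'.arr 16 = s.arr 16 ∧
        ∀ r : Fin k, s'.arr 10 0 r = -genValues C y r := by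
    refine (ensures_loop (fun i s' => Loaded c0 C A b s' ∧ s'.arr 16 = s.arr 16 ∧
      ∀ r : Fin k, (r : ℕ) < i → s'.arr 10 0 r = -genValues C y r)
      ⟨h.of_agree (fun _ _ => rfl) fun _ _ => rfl, rfl, by simp⟩ ?_).imp ?_
    · rintro i hi s₁ ⟨hl, h16, h10⟩
      rw [hk] at hi
      set s₂ := (s₁.setReg 3 i).tick 1 with hs₂
      have hl₂ : Loaded c0 C A b s₂ := hl.of_agree (by simp [hs₂]) (by simp [hs₂])
      have h3 : s₂.reg 3 = i := by simp [hs₂]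
      refine ensures_write_seq ?_
      set s₃ := (s₂.setEntry 10 ((NExp.const 0).eval s₂) ((NExp.reg 3).eval s₂)
        ((RExp.const 0).eval s₂)).tick 1 with hs₃
      have h3₃ : s₃.reg 3 = i := h3
      have h10₃ : s₃.arr 10 0 = Function.update (s₁.arr 10 0) i 0 := by
        rw [hs₃, State.tick_arr, State.setEntry_arr_self]
        simp only [NExp.eval, RExp.eval, h3, Function.update_self]
        simp [hs₂]
      have hkeep₃ : ∀ a ≠ 10, s₃.arr a = s₁.arr a := fun a ha => by
        rw [hs₃, State.tick_arr, State.setEntry_arr_of_ne ha]; rfl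
      have hl₃ : Loaded c0 C A b s₃ := hl₂.of_agree (by simp [hs₃]) fun a ha => by
        rw [hkeep₃ a (by rintro rfl; simp at ha)]; rfl
      have hacc : Ensures O (accumulate (.reg 0) 10 (.const 0) (.reg 3) (.sub (.const 0)
          (.mul (.read 1 (.reg 3) (.reg 4)) (.read 16 (.const 0) (.reg 4))))) s₃ _ :=
        ensures_accumulate (i' := 0) (j' := i) (fun t => -(s₃.arr 1 i t * s₃.arr 16 0 t))
          (hN := hl₃.reg0) (fun _ _ => rfl) (fun s' hr => (hr 3 (by decide)).trans h3₃)
          (fun s' hr ha _ => by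
            simp only [RExp.eval, NExp.eval, hr 3 (by decide), h3₃, ha 1 (by decide),
              ha 16 (by decide)]
            simp)
      refine (hacc.loaded hl₃ (by decide)).mono fun s' _ ha h' => ⟨h'.1, ?_, ?_⟩
      · rw [ha 16 (by decide), hkeep₃ 16 (by decide), h16]
      · intro r hr
        rw [h'.2, Function.update_self, h10₃]
        rcases Nat.lt_succ_iff_lt_or_eq.1 hr with hr | hr
        · rw [Function.update_of_ne hr.ne, Function.update_of_ne hr.ne, h10 r hr]
        · subst hr
          rw [Function.update_self, Function.update_self, zero_add, Finset.sum_range,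
            Finset.sum_neg_distrib]
          simp only [hl₃.arr1, hkeep₃ 16 (by decide), h16, hy]
          rfl
    · rintro s' ⟨hl, h16, h10⟩
      exact ⟨hl, h16, fun r => h10 r (by rw [hk]; exact r.2)⟩
  refine h1.seq ?_
  rintro s₁ ⟨hl₁, h16₁, h10₁⟩
  refine (((ensures_maximize hS hl₁ h10₁).loaded hl₁ (by decide)).mono
    (ψ := fun s' => Loaded c0 C A b s' ∧ s'.arr 16 = s.arr 16 ∧
      (∀ r : Fin k, s'.arr 10 0 r = -genValues C y r) ∧
      ∃ δ : Fin k → ℝ, δ ⬝ᵥ genValues C y = worstCase A b (genValues C y) ∧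
        ∀ r : Fin k, s'.arr 12 0 r = δ r) ?_).seq ?_
  · rintro s' - ha ⟨hl, δ, -, heq, h12⟩
    refine ⟨hl, ?_, ?_, δ, heq, h12⟩
    · rw [ha 16 (by decide), h16₁]
    · rw [ha 10 (by decide)]; exact h10₁
  rintro s₂ ⟨hl₂, h16₂, h10₂, δ, hδ, h12₂⟩
  refine ensures_write_seq ?_
  set s₃ := (s₂.setEntry 17 ((NExp.const 0).eval s₂) ((NExp.const 0).eval s₂)
    ((RExp.const 1).eval s₂)).tick 1 with hs₃
  have hkeep₃ : ∀ a ≠ 17, s₃.arr a = s₂.arr a := fun a ha => by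
    rw [hs₃, State.tick_arr, State.setEntry_arr_of_ne ha]
  have h17₃ : s₃.arr 17 0 0 = 1 := by
    rw [hs₃, State.tick_arr, State.setEntry_arr_self]
    simp [NExp.eval, RExp.eval]
  have hl₃ : Loaded c0 C A b s₃ := hl₂.of_agree (by simp [hs₃]) fun a ha =>
    hkeep₃ a (by rintro rfl; simp at ha)
  have hacc : Ensures O (accumulate (.reg 0) 17 (.const 0) (.const 0)
      (.mul (.read 0 (.const 0) (.reg 4)) (.read 16 (.const 0) (.reg 4)))) s₃ _ :=
    ensures_accumulate (i' := 0) (j' := 0) (fun t => s₃.arr 0 0 t * s₃.arr 16 0 t)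
      (hN := hl₃.reg0) (fun _ _ => rfl) (fun _ _ => rfl)
      (fun s' hr ha _ => by
        simp only [RExp.eval, NExp.eval, ha 0 (by decide), ha 16 (by decide)])
  refine ((hacc.loaded hl₃ (by decide)).mono (ψ := fun s' => Loaded c0 C A b s' ∧
    s'.arr 10 = s₂.arr 10 ∧ s'.arr 12 = s₂.arr 12 ∧ s'.arr 17 0 0 = 1 + c0 ⬝ᵥ y) ?_).seq ?_
  · rintro s' - ha ⟨hl, h17⟩
    refine ⟨hl, ?_, ?_, ?_⟩
    · rw [ha 10 (by decide), hkeep₃ 10 (by decide)]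
    · rw [ha 12 (by decide), hkeep₃ 12 (by decide)]
    · rw [h17, Function.update_self, Function.update_self, h17₃, Finset.sum_range]
      simp only [hl₃.arr0, hkeep₃ 16 (by decide), h16₂, hy]
      rfl
  rintro s₄ ⟨hl₄, h10₄, h12₄, h17₄⟩
  have hacc : Ensures O (accumulate (.reg 1) 17 (.const 0) (.const 0) (.sub (.const 0)
      (.mul (.read 10 (.const 0) (.reg 4)) (.read 12 (.const 0) (.reg 4))))) s₄ _ :=
    ensures_accumulate (i' := 0) (j' := 0) (fun t => -(s₄.arr 10 0 t * s₄.arr 12 0 t))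
      (hN := hl₄.reg1) (fun _ _ => rfl) (fun _ _ => rfl)
      (fun s' hr ha _ => by
        simp only [RExp.eval, NExp.eval, ha 10 (by decide), ha 12 (by decide)]
        simp)
  refine hacc.imp fun s' h17 => ?_
  rw [h17, Function.update_self, Function.update_self, h17₄, Finset.sum_range]
  simp only [h10₄, h12₄, h10₂, h12₂]
  rw [cost, ← hδ, dotProduct_comm δ, ← add_assoc]
  simp [dotProduct]

/-! ### Recording the best solution, and failure probabilities of the search -/

lemma ensures_record : Ensures O record s fun s' =>
    (s.arr 18 0 0 ≤ 1 / s.arr 17 0 0 ∧ s'.arr 18 0 0 = 1 / s.arr 17 0 0 ∧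
      ∀ j < s.reg 0, s'.arr 4 0 j = s.arr 16 0 j) ∨
    (1 / s.arr 17 0 0 < s.arr 18 0 0 ∧ s'.arr 18 = s.arr 18 ∧ s'.arr 4 = s.arr 4) := by
  refine ensures_cond (fun hle => ?_) fun hle => ensures_skip ?_
  · have hle' : s.arr 18 0 0 ≤ 1 / s.arr 17 0 0 := by
      simpa [Test.holds, RExp.eval, NExp.eval] using hle
    refine ensures_write_seq ?_
    set s₁ := ((s.tick 1).setEntry 18 ((NExp.const 0).eval (s.tick 1))
      ((NExp.const 0).eval (s.tick 1)) ((RExp.div (.const 1) (.read 17 (.const 0)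
        (.const 0))).eval (s.tick 1))).tick 1 with hs₁
    have hkeep : ∀ a ≠ 18, s₁.arr a = s.arr a := fun a ha => by
      rw [hs₁, State.tick_arr, State.setEntry_arr_of_ne ha]; rfl
    have h18 : s₁.arr 18 0 0 = 1 / s.arr 17 0 0 := by
      rw [hs₁, State.tick_arr, State.setEntry_arr_self]
      simp [NExp.eval, RExp.eval]
    have hfill : Ensures O (fill (.const 1) (.reg 0) (.write 4 (.reg 3) (.reg 4)
        (.read 16 (.reg 3) (.reg 4)))) s₁ _ :=
      ensures_fill (a := 4) (fun i j => s₁.arr 16 i j) rfl (M := s₁.reg 0)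
        (fun s' h => h 0 (by decide) (by decide)) fun s' _ ha _ _ => ensures_write ⟨rfl,
          fun a' h => State.setEntry_arr_of_ne h _ _ _ _, by
            rw [State.tick_arr, State.setEntry_arr_self]
            simp [RExp.eval, NExp.eval, ha 16 (by decide)]⟩
    refine hfill.mono fun s' hr ha h4 => .inl ⟨hle', ?_, fun j hj => ?_⟩
    · rw [ha 18 (by decide), h18]
    · rw [h4 0 one_pos j hj, hkeep 16 (by decide)]
  · refine .inr ⟨?_, rfl, rfl⟩
    simpa [Test.holds, RExp.eval, NExp.eval] using hle

/-- The invariant of the search: the recorded score is that of the recorded solution. -/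
def Recorded (c0 : Fin n → ℝ) (C : Fin k → Fin n → ℝ) (A : Matrix (Fin m) (Fin k) ℝ)
    (b : Fin m → ℝ) (S : Set (Fin n → ℝ)) (s : State) : Prop :=
  Ready c0 C A b s ∧ (s.arr 18 0 0 = 0 ∨
    (s.output n ∈ S ∧ s.arr 18 0 0 = 1 / (1 + cost c0 C A b (s.output n))))

/-- The two inequalities are what repetition needs: a score once reached is kept, and a single good
`y` suffices. -/
lemma ensures_evaluate_record (hS : Setting c0 C A b S Q O) (h : Recorded c0 C A b S s)
    {y : Fin n → ℝ} (hyS : y ∈ S) (hy : ∀ j : Fin n, s.arr 16 0 j = y j) :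
    Ensures O (.seq evaluate record) s fun s' => Recorded c0 C A b S s' ∧
      s.arr 18 0 0 ≤ s'.arr 18 0 0 ∧ 1 / (1 + cost c0 C A b y) ≤ s'.arr 18 0 0 := by
  refine (((ensures_evaluate hS h.1.toLoaded hy).ready h.1 (by decide) (by decide)).mono
    (ψ := fun s₁ => Ready c0 C A b s₁ ∧ s₁.arr 17 0 0 = 1 + cost c0 C A b y ∧
      s₁.arr 4 = s.arr 4 ∧ s₁.arr 16 = s.arr 16 ∧ s₁.arr 18 = s.arr 18)
    fun s₁ _ ha h => ⟨h.1, h.2, ha 4 (by decide), ha 16 (by decide), ha 18 (by decide)⟩).seq ?_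
  rintro s₁ ⟨hr, h17, h4, h16, h18⟩
  refine (ensures_record.ready hr (by decide) (by decide)).imp ?_
  rw [h17, h18, h16]
  rintro s' ⟨hr', (⟨hle, h18', h4'⟩ | ⟨hlt, h18', h4'⟩)⟩
  · have hout : s'.output n = y := by
      ext j
      rw [State.output, State.vec, h4' j (by rw [hr.reg0]; exact j.2), hy]
    refine ⟨⟨hr', .inr ⟨by rwa [hout], by rw [hout, h18']⟩⟩, ?_, ?_⟩ <;> rw [h18']
    exact hle
  · have hout : s'.output n = s.output n := by
      ext j
      rw [State.output, State.vec, h4', h4]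
      rfl
    refine ⟨⟨hr', ?_⟩, ?_, ?_⟩
    · rw [hout, h18']
      exact h.2
    · rw [h18']
    · rw [h18']
      exact hlt.le

lemma Recorded.after_call (h : Recorded c0 C A b S s) (y : Fin n → ℝ) :
    Recorded c0 C A b S
      { (s.setVec 16 y).tick (n + 1) with calls := s.calls + 1 } := by
  have ha : ∀ a ≠ 16, ({ (s.setVec 16 y).tick (n + 1) with calls := s.calls + 1 } : State).arr a =
      s.arr a := fun a ha => State.setVec_arr_of_ne ha y s
  have hout : ({ (s.setVec 16 y).tick (n + 1) with calls := s.calls + 1 } : State).output n =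
      s.output n := by
    ext j
    exact congrFun (congrFun (ha 4 (by decide)) 0) j
  refine ⟨⟨h.1.toLoaded.of_agree (fun _ _ => rfl) fun a h => ha a (by rintro rfl; simp at h), ?_⟩,
    ?_⟩
  · rw [ha 13 (by decide)]
    exact h.1.arr13
  · rw [hout, ha 18 (by decide)]
    exact h.2

lemma ensures_trial (hS : Setting c0 C A b S Q O) (h : Recorded c0 C A b S s)
    {x : Fin n → ℝ} (hx : x ∈ Q) (h14 : ∀ j : Fin n, s.arr 14 0 j = x j) :
    Ensures O trial s fun s' => Recorded c0 C A b S s' ∧ s.arr 18 0 0 ≤ s'.arr 18 0 0 := by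
  obtain rfl : s.vec 14 n = x := funext h14
  intro s' hs'
  rw [trial, Prog.run, Prog.run, PMF.bind_bind, PMF.mem_support_bind_iff] at hs'
  obtain ⟨y, hy, hs'⟩ := hs'
  rw [PMF.pure_bind] at hs'
  have := ensures_evaluate_record hS (h.after_call y) (hS.support_round _ hx hy)
    (fun j => State.setVec_arr_self 16 y s j) s' hs'
  exact ⟨this.1, this.2.1⟩

/-- After the verifier's answer nothing can go wrong: an answer of cost at most T surely leaves a
score of at least 1 / (1 + T). -/
lemma trial_fail_le (hS : Setting c0 C A b S Q O) (h : Recorded c0 C A b S s)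
    {x : Fin n → ℝ} (hx : x ∈ Q) (h14 : ∀ j : Fin n, s.arr 14 0 j = x j) {T : ℝ}
    (hcost : ∀ y ∈ S, 0 ≤ cost c0 C A b y) :
    (trial.run O s).toOuterMeasure {s' | ¬ 1 / (1 + T) ≤ s'.arr 18 0 0} ≤
      (O.round x).toOuterMeasure {y | ¬ cost c0 C A b y ≤ T} := by
  obtain rfl : s.vec 14 n = x := funext h14
  rw [trial, Prog.run, Prog.run, PMF.bind_bind]
  refine (toOuterMeasure_bind_le _ _ (bad := {y | ¬ cost c0 C A b y ≤ T}) (ε := 1) ?_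
    fun _ _ _ => toOuterMeasure_le_one _ _).trans (mul_one _).le
  intro y hy hb s' hs' hbad
  rw [PMF.pure_bind] at hs'
  have hyS := hS.support_round _ hx hy
  have := ensures_evaluate_record hS (h.after_call y) hyS
    (fun j => State.setVec_arr_self 16 y s j) s' hs'
  refine hbad (le_trans ?_ this.2.2)
  have h0 := hcost y hyS
  have h1 : cost c0 C A b y ≤ T := not_not.1 hb
  exact one_div_le_one_div_of_le (by linarith) (by linarith)

lemma Recorded.of_setReg_tick (h : Recorded c0 C A b S s) {v : ℕ} (hv : v ∉ [0, 1, 2]) (i t : ℕ) :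
    Recorded c0 C A b S ((s.setReg v i).tick t) := by
  refine ⟨⟨h.1.toLoaded.of_agree (fun w hw => ?_) fun _ _ => rfl, h.1.arr13⟩, h.2⟩
  have : w ≠ v := by rintro rfl; exact hv hw
  simp [this]

lemma ensures_attempts (hS : Setting c0 C A b S Q O) (h : Recorded c0 C A b S s)
    {x : Fin n → ℝ} (hx : x ∈ Q) (h14 : ∀ j : Fin n, s.arr 14 0 j = x j) :
    Ensures O attempts s fun s' => Recorded c0 C A b S s' ∧ s.arr 18 0 0 ≤ s'.arr 18 0 0 := by
  refine (ensures_loop (fun _ s' => (Recorded c0 C A b S s' ∧ s.arr 18 0 0 ≤ s'.arr 18 0 0) ∧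
    ∀ j : Fin n, s'.arr 14 0 j = x j) ⟨⟨⟨⟨h.1.toLoaded.of_agree (fun _ _ => rfl) fun _ _ => rfl,
      h.1.arr13⟩, h.2⟩, le_rfl⟩, h14⟩ ?_).imp fun _ h => h.1
  rintro i - s' ⟨⟨hr, hle⟩, h14'⟩
  refine (ensures_trial hS (s := (s'.setReg 6 i).tick 1) (hr.of_setReg_tick (by decide) _ _) hx
    h14').mono fun s'' _ ha h => ⟨⟨h.1, hle.trans h.2⟩, ?_⟩
  rw [ha 14 (by decide)]
  exact h14'

lemma attempts_fail_le (hS : Setting c0 C A b S Q O) (h : Recorded c0 C A b S s)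
    {x : Fin n → ℝ} (hx : x ∈ Q) (h14 : ∀ j : Fin n, s.arr 14 0 j = x j) {T : ℝ}
    (hcost : ∀ y ∈ S, 0 ≤ cost c0 C A b y) :
    (attempts.run O s).toOuterMeasure {s' | ¬ 1 / (1 + T) ≤ s'.arr 18 0 0} ≤
      (O.round x).toOuterMeasure {y | ¬ cost c0 C A b y ≤ T} ^ (n + k + m) := by
  have hL : (NExp.add (.reg 0) (.add (.reg 1) (.reg 2))).eval s = n + k + m := by
    simp only [NExp.eval, h.1.reg0, h.1.reg1, h.1.reg2, add_assoc]
  rw [attempts, Prog.run, hL]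
  -- The invariant includes array 14, so every trial rounds the same x and has the same failure
  -- bound.
  refine (foldl_fail_le_prod (fun s' => Recorded c0 C A b S s' ∧ ∀ j : Fin n, s'.arr 14 0 j = x j)
    (fun s' => 1 / (1 + T) ≤ s'.arr 18 0 0)
    (fun _ => (O.round x).toOuterMeasure {y | ¬ cost c0 C A b y ≤ T}) ?_ _ ?_ ?_ ?_).trans ?_
  · exact ⟨⟨⟨h.1.toLoaded.of_agree (fun _ _ => rfl) fun _ _ => rfl, h.1.arr13⟩, h.2⟩, h14⟩
  · rintro i - s' ⟨hr, h14'⟩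
    refine (ensures_trial hS (s := (s'.setReg 6 i).tick 1) (hr.of_setReg_tick (by decide) _ _) hx
      h14').mono fun s'' _ ha h => ⟨h.1, ?_⟩
    rw [ha 14 (by decide)]
    exact h14'
  · rintro i - s' ⟨hr, h14'⟩ hG
    exact (ensures_trial hS (s := (s'.setReg 6 i).tick 1) (hr.of_setReg_tick (by decide) _ _) hx
      h14').imp fun s'' h => le_trans hG h.2
  · rintro i - s' ⟨hr, h14'⟩
    exact trial_fail_le hS (s := (s'.setReg 6 i).tick 1) (hr.of_setReg_tick (by decide) _ _) hx
      h14' hcost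
  · rw [Finset.prod_const, Finset.card_range]

lemma ensures_relax (hS : Setting c0 C A b S Q O) (h : Recorded c0 C A b S s)
    (hg : s.reg 5 ≤ k) :
    Ensures O relax s fun s' => Recorded c0 C A b S s' ∧ s'.arr 18 = s.arr 18 ∧
      ((s'.reg 7 = 1 ∧ ∃ z, (guessLP c0 C A b (threshold A b (s.reg 5))).IsOptimal Q z ∧
        ∀ j : Fin n, s'.arr 14 0 j = z.1 j) ∨
      (s'.reg 7 = 0 ∧ ∀ z, ¬ (guessLP c0 C A b (threshold A b (s.reg 5))).IsOptimal Q z)) := by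
  classical
  have hfill : Ensures O (fill (.reg 1) (.reg 2)
      (.cond (.realLe (.read 13 (.const 0) (.reg 3)) (.read 13 (.const 0) (.reg 5)))
        (.write 9 (.reg 3) (.reg 4) (.read 2 (.reg 4) (.reg 3)))
        (.write 9 (.reg 3) (.reg 4) (.const 0)))) s _ :=
    ensures_fill (a := 9) (N := k) (M := m) (fun r i =>
        if s.arr 13 0 r ≤ s.arr 13 0 (s.reg 5) then s.arr 2 i r else 0) h.1.reg1
      (fun s' hr => (hr 2 (by decide) (by decide)).trans h.1.reg2) (by
        intro s' hr ha _ _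
        refine ensures_cond (fun ht => ensures_write ⟨rfl,
            fun a' h => State.setEntry_arr_of_ne h _ _ _ _, ?_⟩)
          fun ht => ensures_write ⟨rfl, fun a' h => State.setEntry_arr_of_ne h _ _ _ _, ?_⟩
        all_goals
          simp only [Test.holds, RExp.eval, NExp.eval, ha 13 (by decide),
            hr 5 (by decide) (by decide)] at ht
          rw [State.tick_arr, State.setEntry_arr_self]
          simp [RExp.eval, NExp.eval, ha 2 (by decide), ht])
  refine (((hfill.ready h.1 (by decide) (by decide)).mono (ψ := fun s₁ => Ready c0 C A b s₁ ∧
    s₁.arr 18 = s.arr 18 ∧ s₁.arr 4 = s.arr 4 ∧ ∀ (r : Fin k) (i : Fin m), s₁.arr 9 r i =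
      (guessLP c0 C A b (threshold A b (s.reg 5))).MY r i) ?_)).seq ?_
  · rintro s₁ hr ha ⟨hready, h9⟩
    refine ⟨hready, ha 18 (by decide), ha 4 (by decide), fun r i => ?_⟩
    rw [h9 r r.2 i i.2, h.1.arr13 r r.2.le, h.1.arr13 _ hg, h.1.arr2]
    simp only [threshold, r.2, dif_pos, Fin.eta, guessLP, Matrix.of_apply]
  · rintro s₁ ⟨hready, h18, h4, h9⟩
    have hsolve : Ensures O (.solveLP (.reg 1) (.reg 2) 8 9 7 0 3 14 15 7) s₁ _ :=
      ensures_solveLP hS.solver (q := guessLP c0 C A b (threshold A b (s.reg 5))) (by decide)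
        (rows := .reg 1) (aux := .reg 2) hready.reg1 hready.reg2 hready.arr8 h9
        (fun i => by rw [hready.arr7]; rfl) hready.arr0 hready.arr3 rfl
    refine (hsolve.ready hready (by decide) (by decide)).mono fun s₂ _ ha ⟨hready₂, hres⟩ => ?_
    have h18' : s₂.arr 18 = s.arr 18 := (ha 18 (by decide)).trans h18
    have hout : s₂.output n = s.output n := by
      ext j
      rw [State.output, State.vec, ha 4 (by decide), h4]
      rfl
    refine ⟨⟨hready₂, ?_⟩, h18', hres.imp (fun ⟨h7, z, hz, hX, _⟩ => ⟨h7, z, hz, hX⟩) id⟩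
    rw [h18', hout]
    exact h.2

lemma ensures_guess (hS : Setting c0 C A b S Q O) (h : Recorded c0 C A b S s)
    (hg : s.reg 5 ≤ k) :
    Ensures O guess s fun s' => Recorded c0 C A b S s' ∧ s.arr 18 0 0 ≤ s'.arr 18 0 0 := by
  refine (ensures_relax hS h hg).seq ?_
  rintro s₁ ⟨hr, h18, hres⟩
  have hr' : Recorded c0 C A b S (s₁.tick 1) :=
    ⟨⟨hr.1.toLoaded.of_agree (fun _ _ => rfl) fun _ _ => rfl, hr.1.arr13⟩, hr.2⟩
  rw [← h18]
  refine ensures_cond (fun ht => ?_) fun _ => ensures_skip ⟨hr', le_rfl⟩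
  rcases hres with ⟨-, z, hz, h14⟩ | ⟨h7, -⟩
  · exact ensures_attempts hS hr' hz.1.1 h14
  · simp [Test.holds, NExp.eval, h7] at ht

lemma toOuterMeasure_seq_le {P P' : Prog} {ψ : State → Prop} {B : Set State} {ε : ENNReal}
    (h : Ensures O P s ψ) (h' : ∀ s', ψ s' → (P'.run O s').toOuterMeasure B ≤ ε) :
    ((Prog.seq P P').run O s).toOuterMeasure B ≤ ε := by
  rw [Prog.run]
  refine (toOuterMeasure_bind_le _ _ (bad := Set.univ) (ε := ε) (fun _ _ h => absurd trivial h)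
    fun s' hs' _ => h' s' (h s' hs')).trans ?_
  exact mul_le_of_le_one_left' (toOuterMeasure_le_one _ _)

lemma guess_fail_le (hS : Setting c0 C A b S Q O) (h : Recorded c0 C A b S s)
    (hg : s.reg 5 ≤ k) (hcost : ∀ y ∈ S, 0 ≤ cost c0 C A b y) {T : ℝ} {ε : ENNReal}
    (hopt : ∃ z, (guessLP c0 C A b (threshold A b (s.reg 5))).IsOptimal Q z)
    (hε : ∀ z, (guessLP c0 C A b (threshold A b (s.reg 5))).IsOptimal Q z →
      (O.round z.1).toOuterMeasure {y | ¬ cost c0 C A b y ≤ T} ≤ ε) :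
    (guess.run O s).toOuterMeasure {s' | ¬ 1 / (1 + T) ≤ s'.arr 18 0 0} ≤ ε ^ (n + k + m) := by
  refine toOuterMeasure_seq_le (ensures_relax hS h hg) ?_
  rintro s₁ ⟨hr, h18, ⟨h7, z, hz, h14⟩ | ⟨-, hno⟩⟩
  · have hr' : Recorded c0 C A b S (s₁.tick 1) :=
      ⟨⟨hr.1.toLoaded.of_agree (fun _ _ => rfl) fun _ _ => rfl, hr.1.arr13⟩, hr.2⟩
    rw [Prog.run, if_pos (by simp [Test.holds, NExp.eval, h7])]
    exact (attempts_fail_le hS hr' hz.1.1 h14 hcost).trans (pow_le_pow_left' (hε z hz) _)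
  · obtain ⟨z, hz⟩ := hopt
    exact absurd hz (hno z)

/-- The failure probability of the algorithm: if some guess leads to a solvable relaxation, and
rounding an optimal solution of it fails with probability at most `ε`, then the output fails with
probability at most `ε ^ L`. -/
theorem algorithm_fail_le (hS : Setting c0 C A b S Q O) {g : ℕ} (hg : g ≤ k) {T : ℝ} (hT : 0 ≤ T)
    {ε : ENNReal} (hopt : ∃ z, (guessLP c0 C A b (threshold A b g)).IsOptimal Q z)
    (hε : ∀ z, (guessLP c0 C A b (threshold A b g)).IsOptimal Q z →
      (O.round z.1).toOuterMeasure {y | ¬ cost c0 C A b y ≤ T} ≤ ε) :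
    (algorithm.run O (initState c0 C A b)).toOuterMeasure
      {s | ¬ (s.output n ∈ S ∧ cost c0 C A b (s.output n) ≤ T)} ≤ ε ^ (n + k + m) := by
  have hcost : ∀ y ∈ S, 0 ≤ cost c0 C A b y := fun y hy => by
    refine add_nonneg (dotProduct_nonneg_of_nonneg hS.c0_nonneg fun j => ?_)
      (worstCase_nonneg hS.A_nonneg hS.A_pos hS.b_nonneg _)
    rcases hS.zero_one y hy j with h | h <;> simp [h]
  refine toOuterMeasure_seq_le ensures_prepare_initState ?_
  rintro s₁ ⟨hl, h10, h13, h18⟩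
  refine toOuterMeasure_seq_le (ψ := Recorded c0 C A b S)
    ((ensures_unitWorstCases hS hl h10 h13).mono fun s' _ ha h => ⟨h, .inl ?_⟩) ?_
  · rw [ha 18 (by decide), h18]
  intro s₂ hr
  have hr' : Recorded c0 C A b S (s₂.tick 1) :=
    ⟨⟨hr.1.toLoaded.of_agree (fun _ _ => rfl) fun _ _ => rfl, hr.1.arr13⟩, hr.2⟩
  have hk : (NExp.add (.reg 1) (.const 1)).eval s₂ = k + 1 := by
    simp only [NExp.eval, hr.1.reg1]
  rw [Prog.run, hk]
  have hguess : ∀ i < k + 1, ∀ s, Recorded c0 C A b S s → Ensures O guess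
      ((s.setReg 5 i).tick 1) fun s' => Recorded c0 C A b S s' ∧ s.arr 18 0 0 ≤ s'.arr 18 0 0 :=
    fun i hi s hs => ensures_guess hS (s := (s.setReg 5 i).tick 1)
      (hs.of_setReg_tick (by decide) _ _) (by simpa using Nat.lt_succ_iff.1 hi)
  -- Only guess g is credited. The other guesses are bounded by 1, since they keep the score from
  -- decreasing.
  refine (PMF.toOuterMeasure_mono _ (t := {s' | ¬ 1 / (1 + T) ≤ s'.arr 18 0 0}) ?_).trans
    ((foldl_fail_le_prod (Recorded c0 C A b S) (fun s' => 1 / (1 + T) ≤ s'.arr 18 0 0)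
      (fun i => if i = g then ε ^ (n + k + m) else 1) hr' (k + 1) ?_ ?_ ?_).trans (le_of_eq ?_))
  · rintro s' ⟨hbad, hs'⟩ hle
    have hrec : Recorded c0 C A b S s' := foldl_support_invariant (fun _ => Recorded c0 C A b S)
      hr' (k + 1) (fun i hi s hs => (hguess i hi s hs).imp fun _ h => h.1) s' hs'
    have hpos : 0 < 1 / (1 + T) := by positivity
    -- A score of at least 1 / (1 + T) > 0 also shows that some solution was recorded, so the output
    -- lies in S.
    rcases hrec.2 with h0 | ⟨hS', heq⟩
    · rw [h0] at hle
      linarith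
    · refine hbad ⟨hS', ?_⟩
      have := hcost _ hS'
      rw [heq, one_div_le_one_div (by linarith) (by linarith)] at hle
      linarith
  · exact fun i hi s hs => (hguess i hi s hs).imp fun _ h => h.1
  · exact fun i hi s hs hG => (hguess i hi s hs).imp fun _ h => le_trans hG h.2
  · intro i hi s hs
    split_ifs with h
    · subst h
      have h5 : ((s.setReg 5 i).tick 1).reg 5 = i := by simp
      exact guess_fail_le hS (s := (s.setReg 5 i).tick 1) (hs.of_setReg_tick (by decide) _ _)
        (by rw [h5]; exact hg) hcost (by rw [h5]; exact hopt) (by rw [h5]; exact hε)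
    · exact toOuterMeasure_le_one _ _
  · rw [Finset.prod_ite_eq' (Finset.range (k + 1)) g, if_pos (by simpa using Nat.lt_succ_iff.2 hg)]

end Correctness

/-! ### The relaxation for the right guess -/

section Guess

variable {n k m : ℕ} {c0 : Fin n → ℝ} {C : Fin k → Fin n → ℝ} {A : Matrix (Fin m) (Fin k) ℝ}
  {b : Fin m → ℝ} {S Q : Set (Fin n → ℝ)} {O : Oracles n}

open scoped Classical in
lemma mem_guessLP_feasible {D : ℝ} {z : (Fin n → ℝ) × (Fin m → ℝ)} :
    z ∈ (guessLP c0 C A b D).feasible Q ↔ z.1 ∈ Q ∧ 0 ≤ z.2 ∧ ∀ r, genValues C z.1 r ≤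
      if worstCase A b (Pi.single r 1) ≤ D then (Matrix.transpose A).mulVec z.2 r else 0 := by
  refine and_congr Iff.rfl (and_congr Iff.rfl ?_)
  refine forall_congr' fun r : Fin k => ?_
  have h1 : (guessLP c0 C A b D).MX.mulVec z.1 r = -genValues C z.1 r := by
    change ∑ j, -C r j * z.1 j = _
    simp [genValues, dotProduct]
  have h2 : (guessLP c0 C A b D).MY.mulVec z.2 r =
      if worstCase A b (Pi.single r 1) ≤ D then (Matrix.transpose A).mulVec z.2 r else 0 := by
    change ∑ i, (if worstCase A b (Pi.single r 1) ≤ D then A i r else 0) * z.2 i = _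
    split_ifs
    · rfl
    · simp
  change (0 : ℝ) ≤ (guessLP c0 C A b D).MX.mulVec z.1 r + (guessLP c0 C A b D).MY.mulVec z.2 r ↔ _
  rw [h1, h2]
  constructor <;> intro <;> linarith

/-- Data for the right guess: an optimal solution exists, and all optimal solutions are feasible
for the dual of the inner problem and at most as expensive as the robust optimum. -/
lemma exists_guess (hS : Setting c0 C A b S Q O) (hC : ∃ r j, 0 < C r j) {opt : ℝ} {xs : Fin n → ℝ}
    (hxs : xs ∈ S) (hopt : cost c0 C A b xs = opt) :
    ∃ g ≤ k, 0 ≤ threshold A b g ∧ cMin C * threshold A b g ≤ opt ∧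
      (∃ z, (guessLP c0 C A b (threshold A b g)).IsOptimal Q z) ∧
      ∀ z, (guessLP c0 C A b (threshold A b g)).IsOptimal Q z → cost c0 C A b z.1 ≤ opt ∧
        ∀ r, threshold A b g < worstCase A b (Pi.single r 1) → genValues C z.1 r ≤ 0 := by
  have hQ0 : ∀ x ∈ Q, 0 ≤ x := by
    obtain ⟨p, G, h, rfl⟩ := hS.relaxation.polyhedron
    exact fun x hx => hx.1
  have hxQ := hS.relaxation.subset hxs
  have hx0 := hQ0 xs hxQ
  have hval : ∀ r, 0 ≤ genValues C xs r := fun r =>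
    dotProduct_nonneg_of_nonneg (hS.C_nonneg r) hx0
  have hunit : ∀ r : Fin k, 0 ≤ worstCase A b (Pi.single r 1) := fun r =>
    worstCase_nonneg hS.A_nonneg hS.A_pos hS.b_nonneg _
  have hc0 : 0 ≤ c0 ⬝ᵥ xs := dotProduct_nonneg_of_nonneg hS.c0_nonneg hx0
  have hcost0 : 0 ≤ opt := hopt ▸ add_nonneg hc0
    (worstCase_nonneg hS.A_nonneg hS.A_pos hS.b_nonneg _)
  obtain ⟨g, hg, hg0, hgopt, hgz⟩ : ∃ g ≤ k, 0 ≤ threshold A b g ∧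
      cMin C * threshold A b g ≤ opt ∧
      ∀ r, threshold A b g < worstCase A b (Pi.single r 1) → genValues C xs r = 0 := by
    by_cases hne : ∃ r, 0 < genValues C xs r
    -- The right guess: the active generator with the largest unit worst case.
    · obtain ⟨r, hr, hmax⟩ := (Set.toFinite {r | 0 < genValues C xs r}).exists_maximalFor
        (fun r => worstCase A b (Pi.single r 1)) _ hne
      have ht : threshold A b r = worstCase A b (Pi.single r 1) := by
        simp [threshold]
      refine ⟨r, r.2.le, ht ▸ hunit r, ?_, fun r' hr' => ?_⟩
      · have := mul_worstCase_single_le hS.A_nonneg hS.A_pos hS.b_nonneg hval (cMin_pos C hC)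
          (cMin_le_genValues hS.C_nonneg (hS.zero_one xs hxs) hr)
        rw [ht, ← hopt, cost]
        linarith
      · by_contra hcon
        have hpos : 0 < genValues C xs r' := lt_of_le_of_ne (hval r') (Ne.symm hcon)
        rw [ht] at hr'
        exact absurd (hmax hpos hr'.le) (not_le.2 hr')
    -- No generator is active, so the zero threshold works.
    · push Not at hne
      have ht : threshold A b k = 0 := by simp [threshold]
      exact ⟨k, le_rfl, ht.ge, by rwa [ht, mul_zero], fun r _ => le_antisymm (hne r) (hval r)⟩
  -- A dual optimum for `xs` extends it to a feasible point of the guessed program with objective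
  -- value at most the robust optimum.
  obtain ⟨zs, hzs0, hzs, hzb⟩ := exists_dual (b := b) hS.A_nonneg hS.A_pos (genValues C xs)
  have hfeas : (xs, zs) ∈ (guessLP c0 C A b (threshold A b g)).feasible Q := by
    refine mem_guessLP_feasible.2 ⟨hxQ, hzs0, fun r => ?_⟩
    split_ifs with h
    · exact hzs r
    · exact (hgz r (not_le.1 h)).le
  refine ⟨g, hg, hg0, hgopt, RelaxLP.exists_isOptimal hS.relaxation.isHPoly _ (B := 0)
    ⟨_, hfeas⟩ fun z hz => ?_, fun z hz => ?_⟩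
  · have hz' := mem_guessLP_feasible.1 hz
    exact add_nonneg (dotProduct_nonneg_of_nonneg hS.c0_nonneg (hQ0 _ hz'.1))
      (dotProduct_nonneg_of_nonneg hS.b_nonneg hz'.2.1)
  · obtain ⟨hzQ, hz0, hrow⟩ := mem_guessLP_feasible.1 hz.1
    have hAz : ∀ r, 0 ≤ (Matrix.transpose A).mulVec z.2 r := fun r =>
      Finset.sum_nonneg (s := Finset.univ) (f := fun i => A i r * z.2 i) fun i _ => mul_nonneg (hS.A_nonneg i r) (hz0 i)
    -- Forcing a row to be at most 0 is stronger than the dual constraint, because Aᵀz ≥ 0. So z is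
    -- dual feasible in all rows.
    have hdual : genValues C z.1 ≤ (Matrix.transpose A).mulVec z.2 := by
      intro r
      refine (hrow r).trans ?_
      split_ifs
      · exact le_rfl
      · exact hAz r
    constructor
    · have h1 : c0 ⬝ᵥ z.1 + b ⬝ᵥ z.2 ≤ c0 ⬝ᵥ xs + b ⬝ᵥ zs := hz.2 _ hfeas
      have h2 : worstCase A b (genValues C z.1) ≤ b ⬝ᵥ z.2 :=
        worstCase_le hS.b_nonneg fun δ hδ => dotProduct_le_of_dual hδ hz0 hdual
      rw [← hopt, cost, cost]
      linarith
    · intro r hr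
      have := hrow r
      rwa [if_neg (not_le.2 hr)] at this

end Guess

/-- Only subadditivity is used, so measurability of the events plays no role. -/
lemma one_sub_le_toOuterMeasure_toReal {σ : Type*} (μ : PMF σ) {E B : Set σ} {η : ℝ} (hη : 0 ≤ η)
    (hEB : ∀ s, s ∉ B → s ∈ E) (hB : μ.toOuterMeasure B ≤ ENNReal.ofReal η) :
    1 - η ≤ (μ.toOuterMeasure E).toReal := by
  have h1 : (1 : ENNReal) ≤ μ.toOuterMeasure E + ENNReal.ofReal η := by
    rw [← (μ.toOuterMeasure_apply_eq_one_iff Set.univ).2 (Set.subset_univ _)]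
    refine (μ.toOuterMeasure.mono (s₂ := E ∪ B) fun s _ => ?_).trans
      ((MeasureTheory.measure_union_le E B).trans (add_le_add le_rfl hB))
    by_cases h : s ∈ B
    · exact .inr h
    · exact .inl (hEB s h)
  have hE : μ.toOuterMeasure E ≠ ⊤ := ((toOuterMeasure_le_one μ E).trans_lt ENNReal.one_lt_top).ne
  have h2 := ENNReal.toReal_mono (ENNReal.add_ne_top.2 ⟨hE, ENNReal.ofReal_ne_top⟩) h1
  rw [ENNReal.toReal_add hE ENNReal.ofReal_ne_top, ENNReal.toReal_ofReal hη,
    ENNReal.toReal_one] at h2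
  linarith

end RobustDO

/-! ### Assembly of the main theorem -/

theorem mainTheorem4 :
    ∃ (P : Prog) (K : ℝ) (poly : Polynomial ℕ) (err : ℕ → ℝ),
      Tendsto err atTop (𝓝 0) ∧
      ∀ (n k m : ℕ) (c0 : Fin n → ℝ) (C : Fin k → Fin n → ℝ)
        (A : Matrix (Fin m) (Fin k) ℝ) (b : Fin m → ℝ),
        0 ≤ c0 → 0 ≤ C → (∀ i r, 0 ≤ A i r) → 0 ≤ b →
        0 < beta A → (∃ r j, 0 < C r j) →
      ∀ S Q : Set (Fin n → ℝ),
        S.Nonempty → (∀ x ∈ S, ∀ j, x j = 0 ∨ x j = 1) → IsLPRelaxation S Q →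
      ∀ (α : ℝ) (V : (Fin n → ℝ) → PMF (Fin n → ℝ)),
        1 ≤ α → IsANCRRVerifier α S Q V →
      ∀ solve : (q : RelaxLP n) → Option ((Fin n → ℝ) × (Fin q.aux → ℝ)),
        IsLPSolver Q solve →
        (∀ s ∈ (P.run ⟨solve, V⟩ (initState c0 C A b)).support,
          s.output n ∈ S ∧
          s.calls ≤ poly.eval (n + k + m) ∧
          s.steps ≤ poly.eval (n + k + m)) ∧
        IsRobustWithProb S (uncertaintySet c0 C A b)
          (P.run ⟨solve, V⟩ (initState c0 C A b))
          (K * (α * √((k : ℝ) * Real.log (max (k : ℝ) 2) *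
            (gamma A / beta A) * (cMax C / cMin C))))
          (err (n + k + m)) := by
  refine ⟨algorithm, 18, algorithm.costPoly, fun L => (1 / 2) ^ L,
    tendsto_pow_atTop_nhds_zero_of_lt_one (by norm_num) (by norm_num), ?_⟩
  intro n k m c0 C A b hc0 hC hA hb hβ hCpos S Q hne h01 hrel α V hα hV solve hsolve
  have hAp := exists_pos_of_beta_pos hβ
  have hS : Setting c0 C A b S Q ⟨solve, V⟩ :=
    ⟨hc0, hC, hA, hb, hAp, hne, h01, hrel, hsolve, fun x hx => (hV x hx).mem⟩
  have hfin := finite_of_zero_one h01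
  obtain ⟨xs, hxs, hopt⟩ := exists_robustOpt_eq hfin hne (uncertaintySet c0 C A b)
  rw [robustCost_eq hA hAp hb] at hopt
  obtain ⟨g, hg, hg0, hgopt, hex, hall⟩ := exists_guess hS hCpos hxs (opt := _) hopt.symm
  have hQ0 : ∀ x ∈ Q, 0 ≤ x := by
    obtain ⟨p, G, h, rfl⟩ := hrel.polyhedron
    exact fun x hx => hx.1
  refine ⟨fun s hs => ?_, ?_⟩
  · obtain ⟨M, hM⟩ := (hfin.image (cost c0 C A b)).bddAbove
    -- Sure membership in S: if T bounds the cost on all of S, no rounding fails and ε = 0. Since L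
    -- > 0, the failure probability 0ᴸ is zero, so no state in the support fails.
    have hfail := algorithm_fail_le hS hg (T := max M 0) (le_max_right _ _) (ε := 0) hex
      fun z hz => by
        refine le_of_eq ((PMF.toOuterMeasure_apply_eq_zero_iff _ _).2
          (Set.disjoint_left.2 fun y hy hbad => hbad ?_))
        exact (hM ⟨y, hS.support_round _ hz.1.1 hy, rfl⟩).trans (le_max_left _ _)
    have hL : n + k + m ≠ 0 := by
      obtain ⟨r, j, -⟩ := hCpos
      have := r.pos
      omega
    rw [zero_pow hL, nonpos_iff_eq_zero, PMF.toOuterMeasure_apply_eq_zero_iff] at hfail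
    have hmem := not_not.1 (Set.disjoint_left.1 hfail hs)
    have hsteps := ensures_cost (O := ⟨solve, V⟩) (L := n + k + m) (by omega) (P := algorithm)
      (by decide) (by decide) (initState c0 C A b)
      (by
        intro v hv
        interval_cases v <;> simp [initState] <;> omega) s hs
    simp only [initState, zero_add] at hsteps
    exact ⟨hmem.1, hsteps.2, hsteps.1⟩
  · set ρ := √((k : ℝ) * Real.log (max (k : ℝ) 2) * (gamma A / beta A) * (cMax C / cMin C)) with hρ
    have hκ : 0 ≤ Real.log (max (k : ℝ) 2) := Real.log_nonneg (le_max_of_le_right one_le_two)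
    have hratio : 0 ≤ cMax C / cMin C := by
      obtain ⟨r, j, h⟩ := hCpos
      exact div_nonneg (h.le.trans (le_cMax C r j)) (cMin_pos C ⟨r, j, h⟩).le
    have hγβ : 1 ≤ gamma A / beta A := by
      obtain ⟨r, -⟩ := hCpos
      exact (one_le_div hβ).2 (beta_le_gamma hA r)
    -- The rounding analysis does not need the factor γ/β; as it is at least 1, it may be dropped
    -- here.
    have hρ2 : (k : ℝ) * Real.log (max (k : ℝ) 2) * (cMax C / cMin C) ≤ ρ ^ 2 := by
      rw [hρ, Real.sq_sqrt (by positivity)]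
      refine mul_le_mul_of_nonneg_right (le_mul_of_one_le_right (by positivity) hγβ) hratio
    have hopt0 : 0 ≤ robustOpt S (uncertaintySet c0 C A b) :=
      (mul_nonneg (cMin_pos C hCpos).le hg0).trans hgopt
    have hfail := algorithm_fail_le hS hg
      (T := 18 * (α * ρ) * robustOpt S (uncertaintySet c0 C A b)) (by positivity) (ε := 1 / 2) hex
      fun z hz => toOuterMeasure_bad_le_half hA hAp hb hc0 hC hCpos hfin h01 hα (hQ0 _ hz.1.1)
        (hV _ hz.1.1) hg0 hgopt (hall z hz).1 (hall z hz).2 (Real.sqrt_nonneg _) hρ2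
    refine one_sub_le_toOuterMeasure_toReal _ (by positivity) (fun s hs c hc => ?_)
      (hfail.trans (le_of_eq ?_))
    · exact (dotProduct_le_of_mem_uncertaintySet hA hAp hc _).trans (not_not.1 hs).2
    · rw [ENNReal.ofReal_pow (by norm_num), one_div, one_div,
        ENNReal.ofReal_inv_of_pos (by norm_num)]
      simp
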